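/- Let $n\ge 0$. A Motzkin diagram on $n$ strands is a crossingless partition, into blocks of at most two elements, of $n$ bottom and $n$ top nodes on the two boundary lines of a strip. The Motzkin monoid $\mathcal{M}o_n$ is the set of these diagrams, where $ab$ is obtained by stacking $a$ on top of $b$, gluing the bottom row of $a$ to the top row of $b$, and dropping all components that do not meet the outer rows. A through strand is a block that joins a bottom node to a top node. On a monoid put $a\le_l b\iff \exists c: b=ca$, $a\le_r b\iff\exists c: b=ac$, $a\le_{lr}b\iff\exists c,d: b=cad$. Left cells, right cells and J-cells are the equivalence classes of the relations "$\le$ and $\ge$" for these preorders; J-cells are ordered by $\le_{lr}$; H-cells are the intersections of a left cell and a right cell that lie in the same J-cell. Proposition. All diagrams in a J-cell of $\mathcal{M}o_n$ have the same number of through strands, and the map that sends a J-cell to this number is an order isomorphism from the set of J-cells onto $\{n,n-1,\dots,0\}$ with the reversed order of the integers (so $n$ is the least element). Let $\mathcal{J}_k$ be the J-cell with $k$ through strands, and put $$\ell_{k}=\sum_{t=0}^{n}\frac{k+1}{k+t+1}\binom{n}{k+2t}\binom{k+2t}{t}.$$ Then: 1. $\mathcal{J}_k$ contains exactly $\ell_k$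 left cells and exactly $\ell_k$ right cells. 2. Every left cell $\mathcal{L}\subseteq\mathcal{J}_k$ and every right cell $\mathcal{R}\subseteq\mathcal{J}_k$ has $|\mathcal{L}|=|\mathcal{R}|=\ell_k$ elements, and $|\mathcal{J}_k|=|\mathcal{L}|\cdot|\mathcal{R}|=|\mathcal{L}|^2=\ell_k^2$. 3. $\mathcal{J}_k$ contains an idempotent. 4. Every H-cell $\mathcal{L}\cap\mathcal{R}$ in $\mathcal{J}_k$ has exactly one element, and every H-cell that contains an idempotent is a group under the multiplication of $\mathcal{M}o_n$, isomorphic to the trivial group. -/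

import Mathlib

/-! ### Green's cells of a monoid -/

namespace GreenCell

variable {M : Type*} [Monoid M]

/-- The left order: `a ≤ₗ b` iff `b = c a` for some `c`. -/
def LeftLE (a b : M) : Prop := ∃ c : M, b = c * a

/-- The right order: `a ≤ᵣ b` iff `b = a c` for some `c`. -/
def RightLE (a b : M) : Prop := ∃ c : M, b = a * c

/-- The two-sided order: `a ≤ₗᵣ b` iff `b = c a d` for some `c`, `d`. -/
def TwoSidedLE (a b : M) : Prop := ∃ c d : M, b = c * a * d

/-- Left cells: the equivalence classes of `≤ₗ ∩ ≥ₗ`. -/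
def IsLeftCell (L : Set M) : Prop := ∃ a : M, L = {b | LeftLE a b ∧ LeftLE b a}

/-- Right cells: the equivalence classes of `≤ᵣ ∩ ≥ᵣ`. -/
def IsRightCell (R : Set M) : Prop := ∃ a : M, R = {b | RightLE a b ∧ RightLE b a}

/-- J-cells: the equivalence classes of `≤ₗᵣ ∩ ≥ₗᵣ`. -/
def IsJCell (J : Set M) : Prop := ∃ a : M, J = {b | TwoSidedLE a b ∧ TwoSidedLE b a}

variable (M) in
/-- The type of J-cells of `M`. -/
def JCell : Type _ := {J : Set M // IsJCell J}

/-- The order on J-cells induced by the two-sided order on elements. -/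
instance : LE (JCell M) := ⟨fun J K => ∃ a ∈ J.1, ∃ b ∈ K.1, TwoSidedLE a b⟩

end GreenCell

/-! ### Motzkin diagrams -/

namespace Motzkin

/-- The nodes of a diagram with `n` nodes in each row:
`Sum.inl i` is the `i`-th bottom node and `Sum.inr i` is the `i`-th top node. -/
abbrev Node (n : ℕ) : Type := Fin n ⊕ Fin n

/-- The place of a node on the boundary of the strip, walking along the bottom row from left to
right and then along the top row from right to left. -/
def pos {n : ℕ} : Node n → ℕ
  | Sum.inl i => i
  | Sum.inr i => 2 * n - 1 - i

/-- The nodes of two diagrams stacked on top of each other, with the bottom row of the upper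
diagram identified with the top row of the lower one: bottom, middle and top row. -/
inductive StackNode (n : ℕ) : Type
  | bottom (i : Fin n)
  | middle (i : Fin n)
  | top (i : Fin n)

/-- The nodes of the lower diagram in the stack. -/
def StackNode.lower {n : ℕ} : Node n → StackNode n
  | Sum.inl i => .bottom i
  | Sum.inr i => .middle i

/-- The nodes of the upper diagram in the stack. -/
def StackNode.upper {n : ℕ} : Node n → StackNode n
  | Sum.inl i => .middle i
  | Sum.inr i => .top i

/-- The nodes of the composite in the stack. -/
def StackNode.outer {n : ℕ} : Node n → StackNode n
  | Sum.inl i => .bottom i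
  | Sum.inr i => .top i

/-- Two nodes of the stack are directly linked if they lie in the same block of the upper diagram
or in the same block of the lower diagram. -/
inductive StackLink {n : ℕ} (a b : Setoid (Node n)) : StackNode n → StackNode n → Prop
  | upper {u v : Node n} : a u v → StackLink a b (.upper u) (.upper v)
  | lower {u v : Node n} : b u v → StackLink a b (.lower u) (.lower v)

/-- Composition of partitions, `a` on top of `b`: two outer nodes lie in the same block iff they
are connected in the stack. Components that lie inside the middle row are dropped. -/
def stackRel {n : ℕ} (a b : Setoid (Node n)) : Setoid (Node n) :=
  Setoid.comap StackNode.outer (Relation.EqvGen.setoid (StackLink a b))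

/-- A Motzkin diagram: a crossingless partition of the `n` bottom and `n` top nodes into blocks
of at most two elements. -/
@[ext]
structure Diagram (n : ℕ) where
  rel : Setoid (Node n)
  card_le_two : ∀ x y z : Node n, rel x y → rel x z → x = y ∨ x = z ∨ y = z
  crossingless : ∀ w x y z : Node n, pos w < pos x → pos x < pos y → pos y < pos z →
    rel w y → ¬ rel x z

/-- The number of through strands: blocks that join a bottom node `p.1` to a top node `p.2`. -/
noncomputable def Diagram.throughStrands {n : ℕ} (a : Diagram n) : ℕ :=
  {p : Fin n × Fin n | a.rel (Sum.inl p.1) (Sum.inr p.2)}.ncard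

/-! The composite of two Motzkin diagrams is a Motzkin diagram. The nodes of both diagrams are
placed on a line, so that the glued nodes are nested around position `N`, and are then glued in
pairs, from the innermost pair outwards. -/

/-- Merging the blocks of `p` and `q`. -/
def merge (r : ℕ → ℕ → Prop) (p q x y : ℕ) : Prop :=
  r x y ∨ (r x p ∧ r q y) ∨ (r x q ∧ r p y)

theorem merge_equivalence {r : ℕ → ℕ → Prop} (h : Equivalence r) (p q : ℕ) :
    Equivalence (merge r p q) := by
  obtain ⟨h1, h2, h3⟩ := h
  refine ⟨fun x => Or.inl (h1 x), ?_, ?_⟩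
  · intro x y hxy
    unfold merge at *
    grind
  · intro x y z hxy hyz
    unfold merge at *
    grind

/-- The first `j` glued pairs have been merged. -/
def glue (r : ℕ → ℕ → Prop) (N : ℕ) : ℕ → ℕ → ℕ → Prop
  | 0 => r
  | j + 1 => merge (glue r N j) (N - 1 - j) (N + j)

theorem glue_equivalence {r : ℕ → ℕ → Prop} (h : Equivalence r) (N j : ℕ) :
    Equivalence (glue r N j) := by
  induction j with
  | zero => exact h
  | succ j ih => exact merge_equivalence ih _ _

/-- The relation is a crossingless partial matching on the points outside `[N - j, N + j)`. -/
def IsMotzkinOff (r : ℕ → ℕ → Prop) (N j : ℕ) : Prop :=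
  (∀ x y z, (x + j < N ∨ N + j ≤ x) → (y + j < N ∨ N + j ≤ y) → (z + j < N ∨ N + j ≤ z) →
    r x y → r x z → x = y ∨ x = z ∨ y = z) ∧
  (∀ w x y z, (w + j < N ∨ N + j ≤ w) → (x + j < N ∨ N + j ≤ x) → (y + j < N ∨ N + j ≤ y) →
    (z + j < N ∨ N + j ≤ z) → w < x → x < y → y < z → r w y → ¬ r x z)

theorem isMotzkinOff_merge {r : ℕ → ℕ → Prop} (h : Equivalence r) {N j : ℕ} (hj : j < N)
    (hr : IsMotzkinOff r N j) : IsMotzkinOff (merge r (N - 1 - j) (N + j)) N (j + 1) := by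
  obtain ⟨h1, h2, h3⟩ := h
  obtain ⟨two, cross⟩ := hr
  obtain ⟨p, hp⟩ : ∃ p, p = N - 1 - j := ⟨_, rfl⟩
  obtain ⟨q, hq⟩ : ∃ q, q = N + j := ⟨_, rfl⟩
  obtain ⟨X, hX⟩ : ∃ X : ℕ → Prop, X = fun x => x + j < N ∨ N + j ≤ x := ⟨_, rfl⟩
  have two' : ∀ x y z, X x → X y → X z → r x y → r x z → x = y ∨ x = z ∨ y = z := by
    intro x y z; rw [hX]; exact two x y z
  have cross' : ∀ w x y z, X w → X x → X y → X z → w < x → x < y → y < z → r w y → r x z →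
      False := by
    intro w x y z; rw [hX]; exact cross w x y z
  have hXp : X p := by rw [hX]; dsimp only; omega
  have hXq : X q := by rw [hX]; dsimp only; omega
  have hpq : p < q := by omega
  have key : ∀ x, (x + (j + 1) < N ∨ N + (j + 1) ≤ x) → X x ∧ (x < p ∨ q < x) := by
    intro x hx
    rw [hX]
    dsimp only
    omega
  rw [← hp, ← hq]
  clear hp hq hX two cross
  constructor
  · intro x y z hx hy hz hxy hxz
    obtain ⟨hx, hx'⟩ := key x hx
    obtain ⟨hy, hy'⟩ := key y hy
    obtain ⟨hz, hz'⟩ := key z hz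
    clear key cross'
    unfold merge at *
    rcases hxy with hxy | ⟨hxy, hxy'⟩ | ⟨hxy, hxy'⟩ <;>
      rcases hxz with hxz | ⟨hxz, hxz'⟩ | ⟨hxz, hxz'⟩ <;> grind
  · intro w x y z hw hx hy hz hwx hxy hyz hwy hxz
    obtain ⟨hx, hx'⟩ := key x hx
    obtain ⟨hy, hy'⟩ := key y hy
    obtain ⟨hz, hz'⟩ := key z hz
    obtain ⟨hw, hw'⟩ := key w hw
    clear key
    have c1 := cross' w x y z hw hx hy hz hwx hxy hyz
    -- chords through `p` or `q` cannot cross the chord from `u` to `v`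
    have sep : ∀ u v s t, X u → X v → X s → X t → r u v → u < s → s < v →
        (t < u ∨ v < t) → ¬ r s t := by
      intro u v s t hu hv hs ht huv hus hsv hst hrst
      rcases hst with hst | hst
      · exact cross' t u s v ht hu hs hv hst hus hsv (h2 hrst) huv
      · exact cross' u s v t hu hs hv ht hus hsv hst huv hrst
    have main : ∀ u v s t, X u → X v → X s → X t → r u v → u < s → s < v →
        (t < u ∨ v < t) → (u < p ∨ q < u) → (v < p ∨ q < v) → ¬ (r s p ∧ r t q) ∧
        ¬ (r s q ∧ r t p) := by
      intro u v s t hu hv hs ht huv hus hsv hst hu' hv'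
      have a1 := sep u v s p hu hv hs hXp huv hus hsv
      have a2 := sep u v s q hu hv hs hXq huv hus hsv
      have a3 : u < p → p < v → ¬ r p t := fun h h' => sep u v p t hu hv hXp ht huv h h' hst
      have a4 : u < q → q < v → ¬ r q t := fun h h' => sep u v q t hu hv hXq ht huv h h' hst
      constructor
      · rintro ⟨b1, b2⟩
        have b3 := h2 b2
        by_cases hc : u < p ∧ p < v
        · exact a4 (by omega) (by omega) b3
        · exact a1 (by omega) b1
      · rintro ⟨b1, b2⟩
        have b3 := h2 b2
        by_cases hc : u < p ∧ p < v
        · exact a3 (by omega) (by omega) b3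
        · exact a2 (by omega) b1
    have m1 := main w y x z hw hy hx hz
    have m2 := main x z y w hx hz hy hw
    unfold merge at *
    rcases hwy with hwy | ⟨hwy, hwy'⟩ | ⟨hwy, hwy'⟩
    · have m1 := m1 hwy hwx hxy (Or.inr hyz) hw' hy'
      rcases hxz with hxz | ⟨hxz, hxz'⟩ | ⟨hxz, hxz'⟩
      · exact c1 hwy hxz
      · exact m1.1 ⟨hxz, h2 hxz'⟩
      · exact m1.2 ⟨hxz, h2 hxz'⟩
    all_goals
      rcases hxz with hxz | ⟨hxz, hxz'⟩ | ⟨hxz, hxz'⟩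
      · have m2 := m2 hxz hxy hyz (Or.inl hwx) hx' hz'
        first
        | exact m2.2 ⟨h2 hwy', hwy⟩
        | exact m2.1 ⟨h2 hwy', hwy⟩
      all_goals
        first
        | have := two' p w x hXp hw hx (h2 hwy) (h2 hxz)
          omega
        | have := two' q w x hXq hw hx (h2 hwy) (h2 hxz)
          omega
        | have := two' p w z hXp hw hz (h2 hwy) hxz'
          omega
        | have := two' q w z hXq hw hz (h2 hwy) hxz'
          omega

theorem isMotzkinOff_glue {r : ℕ → ℕ → Prop} (h : Equivalence r) {N : ℕ}
    (hr : IsMotzkinOff r N 0) (j : ℕ) (hj : j ≤ N) : IsMotzkinOff (glue r N j) N j := by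
  induction j with
  | zero => exact hr
  | succ j ih => exact isMotzkinOff_merge (glue_equivalence h N j) hj (ih (by omega))

theorem glue_mono {r : ℕ → ℕ → Prop} {N i j x y : ℕ} (hij : i ≤ j) (h : glue r N i x y) :
    glue r N j x y := by
  induction j, hij using Nat.le_induction with
  | base => exact h
  | succ j _ ih => exact Or.inl ih

theorem glue_pair {r : ℕ → ℕ → Prop} (h : Equivalence r) {N i j : ℕ} (hij : i < j) :
    glue r N j (N - 1 - i) (N + i) :=
  glue_mono (i := i + 1) hij
    (Or.inr (Or.inl ⟨(glue_equivalence h N i).1 _, (glue_equivalence h N i).1 _⟩))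

theorem pos_lt {n : ℕ} (u : Node n) : pos u < 2 * n := by
  rcases u with i | i <;> simp only [pos] <;> omega

theorem pos_injective {n : ℕ} : Function.Injective (pos (n := n)) := by
  rintro (i | i) (j | j) h <;> simp only [pos] at h
  · exact congrArg _ (Fin.ext h)
  · omega
  · omega
  · exact congrArg _ (Fin.ext (by omega))

/-- Both diagrams on a line, the lower one `b` to the left of the upper one `a`. -/
def lineRel {n : ℕ} (a b : Diagram n) (x y : ℕ) : Prop :=
  x = y ∨ (∃ u v, b.rel u v ∧ x = pos u ∧ y = pos v) ∨
    ∃ u v, a.rel u v ∧ x = 2 * n + pos u ∧ y = 2 * n + pos v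

theorem lineRel_equivalence {n : ℕ} (a b : Diagram n) : Equivalence (lineRel a b) := by
  refine ⟨fun x => Or.inl rfl, ?_, ?_⟩
  · rintro x y (h | ⟨u, v, h, hu, hv⟩ | ⟨u, v, h, hu, hv⟩)
    · exact Or.inl h.symm
    · exact Or.inr (Or.inl ⟨v, u, b.rel.symm h, hv, hu⟩)
    · exact Or.inr (Or.inr ⟨v, u, a.rel.symm h, hv, hu⟩)
  · rintro x y z (rfl | ⟨u, v, h, hu, hv⟩ | ⟨u, v, h, hu, hv⟩) h'
    · exact h'
    · rcases h' with rfl | ⟨u', v', h', hu', hv'⟩ | ⟨u', v', h', hu', hv'⟩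
      · exact Or.inr (Or.inl ⟨u, v, h, hu, hv⟩)
      · obtain rfl : v = u' := pos_injective (hv.symm.trans hu')
        exact Or.inr (Or.inl ⟨u, v', b.rel.trans h h', hu, hv'⟩)
      · have := pos_lt v
        omega
    · rcases h' with rfl | ⟨u', v', h', hu', hv'⟩ | ⟨u', v', h', hu', hv'⟩
      · exact Or.inr (Or.inr ⟨u, v, h, hu, hv⟩)
      · have := pos_lt u'
        omega
      · obtain rfl : v = u' := pos_injective (by omega)
        exact Or.inr (Or.inr ⟨u, v', a.rel.trans h h', hu, hv'⟩)

theorem lineRel_isMotzkinOff {n : ℕ} (a b : Diagram n) :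
    IsMotzkinOff (lineRel a b) (2 * n) 0 := by
  constructor
  · rintro x y z - - - (h | ⟨u, v, h, hu, hv⟩ | ⟨u, v, h, hu, hv⟩) h'
    · exact Or.inl h
    · rcases h' with h' | ⟨u', v', h', hu', hv'⟩ | ⟨u', v', h', hu', hv'⟩
      · exact Or.inr (Or.inl h')
      · obtain rfl : u = u' := pos_injective (by omega)
        rcases b.card_le_two u v v' h h' with rfl | rfl | rfl <;> omega
      · have := pos_lt u
        omega
    · rcases h' with h' | ⟨u', v', h', hu', hv'⟩ | ⟨u', v', h', hu', hv'⟩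
      · exact Or.inr (Or.inl h')
      · have := pos_lt u'
        omega
      · obtain rfl : u = u' := pos_injective (by omega)
        rcases a.card_le_two u v v' h h' with rfl | rfl | rfl <;> omega
  · rintro w x y z - - - - hwx hxy hyz (h | ⟨u, v, h, hu, hv⟩ | ⟨u, v, h, hu, hv⟩)
      (h' | ⟨u', v', h', hu', hv'⟩ | ⟨u', v', h', hu', hv'⟩)
    any_goals omega
    · exact b.crossingless u u' v v' (by omega) (by omega) (by omega) h h'
    · have := pos_lt v
      omega
    · have := pos_lt v'
      omega
    · exact a.crossingless u u' v v' (by omega) (by omega) (by omega) h h'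

/-- The place of a node of the stack on the line. -/
def StackNode.linePos {n : ℕ} : StackNode n → ℕ
  | .bottom i => i
  | .middle i => 2 * n + i
  | .top i => 2 * n + (2 * n - 1 - i)

theorem glue_of_stack {n : ℕ} (a b : Diagram n) {x y : StackNode n}
    (h : Relation.EqvGen (StackLink a.rel b.rel) x y) :
    glue (lineRel a b) (2 * n) n x.linePos y.linePos := by
  have e := lineRel_equivalence a b
  have E := glue_equivalence e (2 * n) n
  have low : ∀ u : Node n, glue (lineRel a b) (2 * n) n (StackNode.lower u).linePos (pos u) := by
    rintro (i | i)
    · exact E.1 _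
    · have := glue_pair e (N := 2 * n) (i := i) (j := n) i.2
      exact E.2 this
  have upp : ∀ u : Node n, (StackNode.upper u).linePos = 2 * n + pos u := by
    rintro (i | i) <;> rfl
  induction h with
  | rel x y h =>
    cases h with
    | upper h =>
      rw [upp, upp]
      exact glue_mono (Nat.zero_le _) (Or.inr (Or.inr ⟨_, _, h, rfl, rfl⟩))
    | lower h =>
      exact E.3 (low _) (E.3 (glue_mono (Nat.zero_le _) (Or.inr (Or.inl ⟨_, _, h, rfl, rfl⟩)))
        (E.2 (low _)))
  | refl x => exact E.1 _
  | symm x y _ ih => exact E.2 ih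
  | trans x y z _ _ ih1 ih2 => exact E.3 ih1 ih2

theorem outer_off {n : ℕ} (u : Node n) : (StackNode.outer u).linePos + n < 2 * n ∨
    2 * n + n ≤ (StackNode.outer u).linePos := by
  rcases u with i | i <;> simp only [StackNode.outer, StackNode.linePos] <;> omega

theorem outer_lt {n : ℕ} {u v : Node n} (h : pos u < pos v) :
    (StackNode.outer u).linePos < (StackNode.outer v).linePos := by
  rcases u with i | i <;> rcases v with j | j <;>
    simp only [StackNode.outer, StackNode.linePos, pos] at * <;> omega

theorem outer_injective {n : ℕ} {u v : Node n}
    (h : (StackNode.outer u).linePos = (StackNode.outer v).linePos) : u = v := by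
  apply pos_injective
  rcases lt_trichotomy (pos u) (pos v) with h' | h' | h'
  · have := outer_lt h'
    omega
  · exact h'
  · have := outer_lt h'
    omega

/-- Composition of Motzkin diagrams: `a * b` is `a` stacked on top of `b`, where closed loops and
loose strands in the middle are dropped. -/
instance {n : ℕ} : Mul (Diagram n) where
  mul a b :=
    { rel := stackRel a.rel b.rel
      card_le_two := by
        intro x y z hxy hxz
        have := (isMotzkinOff_glue (lineRel_equivalence a b) (lineRel_isMotzkinOff a b) n
          (by omega)).1 _ _ _ (outer_off x) (outer_off y) (outer_off z)
          (glue_of_stack a b hxy) (glue_of_stack a b hxz)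
        rcases this with h | h | h
        · exact Or.inl (outer_injective h)
        · exact Or.inr (Or.inl (outer_injective h))
        · exact Or.inr (Or.inr (outer_injective h))
      crossingless := by
        intro w x y z hwx hxy hyz hwy hxz
        exact (isMotzkinOff_glue (lineRel_equivalence a b) (lineRel_isMotzkinOff a b) n
          (by omega)).2 _ _ _ _ (outer_off w) (outer_off x) (outer_off y) (outer_off z)
          (outer_lt hwx) (outer_lt hxy) (outer_lt hyz)
          (glue_of_stack a b hwy) (glue_of_stack a b hxz) }

/-- The index of the column of a node. -/
def column {n : ℕ} : Node n → Fin n := Sum.elim id id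

/-- The identity diagram: the `i`-th bottom node is joined to the `i`-th top node. -/
instance {n : ℕ} : One (Diagram n) where
  one :=
    { rel := Setoid.ker column
      card_le_two := by
        rintro (x | x) (y | y) (z | z) h h' <;>
          simp only [Setoid.ker_def, column, Sum.elim_inl, Sum.elim_inr, id] at h h' <;>
          simp [← h, ← h']
      crossingless := by
        rintro (w | w) (x | x) (y | y) (z | z) hwx hxy hyz h h' <;>
          simp only [Setoid.ker_def, column, Sum.elim_inl, Sum.elim_inr, id] at h h' <;>
          simp only [pos] at hwx hxy hyz <;> subst h h' <;> omega }

theorem mul_rel {n : ℕ} (a b : Diagram n) : (a * b).rel = stackRel a.rel b.rel := rfl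

theorem stackRel_iff {n : ℕ} (a b : Setoid (Node n)) (x y : Node n) :
    stackRel a b x y ↔
      Relation.EqvGen (StackLink a b) (StackNode.outer x) (StackNode.outer y) := Iff.rfl

/-- To bound a composite from above it is enough to label the nodes of the stack so that linked
nodes have the same label. -/
theorem label_eq {n : ℕ} {a b : Setoid (Node n)} {β : Type*} (f : StackNode n → β)
    (ha : ∀ u v, a u v → f (.upper u) = f (.upper v))
    (hb : ∀ u v, b u v → f (.lower u) = f (.lower v)) {x y : StackNode n}
    (h : Relation.EqvGen (StackLink a b) x y) : f x = f y := by
  induction h with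
  | rel x y h =>
    cases h with
    | upper h => exact ha _ _ h
    | lower h => exact hb _ _ h
  | refl x => rfl
  | symm x y _ ih => exact ih.symm
  | trans x y z _ _ ih1 ih2 => exact ih1.trans ih2

theorem stack_map {n : ℕ} {a b : Setoid (Node n)} {β : Type*} (f : StackNode n → β)
    (s : Setoid β) (ha : ∀ u v, a u v → s (f (.upper u)) (f (.upper v)))
    (hb : ∀ u v, b u v → s (f (.lower u)) (f (.lower v))) {x y : StackNode n}
    (h : Relation.EqvGen (StackLink a b) x y) : s (f x) (f y) :=
  Quotient.exact (label_eq (fun x => (⟦f x⟧ : Quotient s))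
    (fun u v huv => Quotient.sound (ha u v huv)) (fun u v huv => Quotient.sound (hb u v huv)) h)

theorem one_stackRel {n : ℕ} (b : Setoid (Node n)) :
    stackRel (1 : Diagram n).rel b = b := by
  ext x y
  rw [stackRel_iff]
  have key : ∀ i : Fin n, Relation.EqvGen (StackLink (1 : Diagram n).rel b) (.middle i) (.top i) :=
    fun i => .rel _ _ (.upper (u := Sum.inl i) (v := Sum.inr i) rfl)
  have low : ∀ u : Node n, Relation.EqvGen (StackLink (1 : Diagram n).rel b) (.lower u)
      (.outer u) := by
    rintro (i | i)
    · exact .refl _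
    · exact key i
  let f : StackNode n → Node n
    | .bottom i => Sum.inl i
    | .middle i => Sum.inr i
    | .top i => Sum.inr i
  have fo : ∀ u, f (.outer u) = u := by rintro (i | i) <;> rfl
  constructor
  · intro h
    have := stack_map f b ?_ ?_ h
    · rwa [fo, fo] at this
    · rintro (i | i) (j | j) h <;> obtain rfl : i = j := h <;> exact b.refl _
    · rintro (i | i) (j | j) h <;> exact h
  · intro h
    exact ((low x).symm.trans _ _ _ (.rel _ _ (.lower h))).trans _ _ _ (low y)

theorem stackRel_one {n : ℕ} (a : Setoid (Node n)) :
    stackRel a (1 : Diagram n).rel = a := by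
  ext x y
  rw [stackRel_iff]
  have key : ∀ i : Fin n,
      Relation.EqvGen (StackLink a (1 : Diagram n).rel) (.bottom i) (.middle i) :=
    fun i => .rel _ _ (.lower (u := Sum.inl i) (v := Sum.inr i) rfl)
  have upp : ∀ u : Node n, Relation.EqvGen (StackLink a (1 : Diagram n).rel) (.outer u)
      (.upper u) := by
    rintro (i | i)
    · exact key i
    · exact .refl _
  let f : StackNode n → Node n
    | .bottom i => Sum.inl i
    | .middle i => Sum.inl i
    | .top i => Sum.inr i
  have fo : ∀ u, f (.outer u) = u := by rintro (i | i) <;> rfl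
  constructor
  · intro h
    have := stack_map f a ?_ ?_ h
    · rwa [fo, fo] at this
    · rintro (i | i) (j | j) h <;> exact h
    · rintro (i | i) (j | j) h <;> obtain rfl : i = j := h <;> exact a.refl _
  · intro h
    exact ((upp x).trans _ _ _ (.rel _ _ (.upper h))).trans _ _ _ (upp y).symm

theorem stackRel_assoc_le {n : ℕ} {a b c : Setoid (Node n)} {x y : Node n}
    (h : stackRel (stackRel a b) c x y) : stackRel a (stackRel b c) x y := by
  -- label the rows of the triple stack by classes of the stack of `a` over `b c`
  let bc := Relation.EqvGen.setoid (StackLink b c)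
  let m := Relation.EqvGen.setoid (StackLink a (stackRel b c))
  let g : StackNode n → Set (StackNode n) := fun s => {z | ∃ w, bc (.outer w) s ∧ m (.lower w) z}
  have m_class : ∀ {s t}, m s t → {z | m s z} = {z | m t z} := by
    intro s t hst
    ext z
    exact ⟨fun h => m.trans (m.symm hst) h, fun h => m.trans hst h⟩
  have g_class : ∀ {s t}, bc s t → g s = g t := by
    intro s t hst
    ext z
    exact ⟨fun ⟨w, h1, h2⟩ => ⟨w, bc.trans h1 hst, h2⟩,
      fun ⟨w, h1, h2⟩ => ⟨w, bc.trans h1 (bc.symm hst), h2⟩⟩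
  have g_outer : ∀ w, g (.outer w) = {z | m (.lower w) z} := by
    intro w
    ext z
    constructor
    · rintro ⟨w', h1, h2⟩
      exact m.trans (m.symm (.rel _ _ (.lower h1))) h2
    · intro hz
      exact ⟨w, bc.refl _, hz⟩
  let f : StackNode n → Set (StackNode n)
    | .bottom i => g (.bottom i)
    | .middle i => g (.middle i)
    | .top i => {z | m (.top i) z}
  let k : StackNode n → Set (StackNode n)
    | .bottom i => g (.middle i)
    | .middle i => g (.top i)
    | .top i => {z | m (.top i) z}
  have f_outer : ∀ u, f (.outer u) = {z | m (.outer u) z} := by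
    rintro (i | i)
    · exact g_outer (Sum.inl i)
    · rfl
  have f_lower : ∀ u, f (.lower u) = g (.lower u) := by rintro (i | i) <;> rfl
  have f_upper : ∀ u, f (.upper u) = k (.outer u) := by rintro (i | i) <;> rfl
  have k_lower : ∀ u, k (.lower u) = g (.upper u) := by rintro (i | i) <;> rfl
  have k_upper : ∀ u, k (.upper u) = {z | m (.upper u) z} := by
    rintro (i | i)
    · exact g_outer (Sum.inr i)
    · rfl
  have hf : f (.outer x) = f (.outer y) := by
    refine label_eq f ?_ ?_ h
    · intro u v huv
      rw [f_upper, f_upper]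
      refine label_eq k ?_ ?_ huv
      · intro u v huv
        rw [k_upper, k_upper]
        exact m_class (.rel _ _ (.upper huv))
      · intro u v huv
        rw [k_lower, k_lower]
        exact g_class (.rel _ _ (.upper huv))
    · intro u v huv
      rw [f_lower, f_lower]
      exact g_class (.rel _ _ (.lower huv))
  rw [f_outer, f_outer] at hf
  have hy : StackNode.outer y ∈ {z | m (.outer y) z} := m.refl _
  rw [← hf] at hy
  exact hy

/-- Reflection of a partition in the horizontal axis. -/
def flip {n : ℕ} (a : Setoid (Node n)) : Setoid (Node n) := Setoid.comap Sum.swap a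

theorem flip_iff {n : ℕ} (a : Setoid (Node n)) (x y : Node n) :
    flip a x y ↔ a x.swap y.swap := Iff.rfl

theorem flip_stackRel {n : ℕ} {a b : Setoid (Node n)} {x y : Node n} (h : stackRel a b x y) :
    stackRel (flip b) (flip a) x.swap y.swap := by
  let f : StackNode n → StackNode n
    | .bottom i => .top i
    | .middle i => .middle i
    | .top i => .bottom i
  have f_outer : ∀ u : Node n, f (.outer u) = .outer u.swap := by rintro (i | i) <;> rfl
  have f_upper : ∀ u : Node n, f (.upper u) = .lower u.swap := by rintro (i | i) <;> rfl
  have f_lower : ∀ u : Node n, f (.lower u) = .upper u.swap := by rintro (i | i) <;> rfl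
  rw [stackRel_iff, ← f_outer, ← f_outer]
  refine stack_map f (Relation.EqvGen.setoid _) ?_ ?_ h
  · intro u v huv
    rw [f_upper, f_upper]
    exact .rel _ _ (.lower (by rwa [flip_iff, Sum.swap_swap, Sum.swap_swap]))
  · intro u v huv
    rw [f_lower, f_lower]
    exact .rel _ _ (.upper (by rwa [flip_iff, Sum.swap_swap, Sum.swap_swap]))

theorem flip_flip {n : ℕ} (a : Setoid (Node n)) : flip (flip a) = a := by
  ext x y
  rw [flip_iff, flip_iff, Sum.swap_swap, Sum.swap_swap]

theorem stackRel_flip {n : ℕ} (a b : Setoid (Node n)) :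
    stackRel (flip b) (flip a) = flip (stackRel a b) := by
  ext x y
  constructor
  · intro h
    have := flip_stackRel h
    rwa [flip_flip, flip_flip] at this
  · intro h
    have := flip_stackRel (x := x.swap) (y := y.swap) h
    rwa [Sum.swap_swap, Sum.swap_swap] at this

theorem stackRel_assoc {n : ℕ} (a b c : Setoid (Node n)) :
    stackRel (stackRel a b) c = stackRel a (stackRel b c) := by
  ext x y
  refine ⟨stackRel_assoc_le, fun h => ?_⟩
  have h1 := flip_stackRel h
  rw [← stackRel_flip] at h1
  have h2 := flip_stackRel (stackRel_assoc_le h1)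
  rwa [← stackRel_flip, flip_flip, flip_flip, flip_flip, Sum.swap_swap, Sum.swap_swap] at h2

instance {n : ℕ} : Monoid (Diagram n) where
  mul_assoc a b c := Diagram.ext (stackRel_assoc a.rel b.rel c.rel)
  one_mul a := Diagram.ext (one_stackRel a.rel)
  mul_one a := Diagram.ext (stackRel_one a.rel)

end Motzkin

/-!
A diagram is determined by its bottom and top halves, obtained by cutting the through strands: the
cut strands leave defects, and since strands do not cross there is exactly one way to join two
halves with equally many defects. If the bottom half of `c` equals the top half of `a`, then `c * a`
has the bottom half of `a` and the top half of `c`. So the diagrams with `k` through strands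
multiply like matrix units modulo diagrams with fewer strands: the left and right cells are the
fibres of the bottom and top half, and an H-cell is a pair of halves.

Removing the last point of a half shows that the number of halves with `k` defects satisfies the
recursion of the Motzkin triangle. The claimed sum satisfies it too, because the ballot numbers
`(k + 1) / (k + t + 1) * (k + 2 * t).choose t` obey a Pascal-type recursion.
-/

namespace GreenCell

section Monoid

variable {M : Type*} [Monoid M]

theorem setOf_twoSidedLE_antisymm {α : Type*} [PartialOrder α] {f : M → α}
    (hf : ∀ a b, TwoSidedLE a b ↔ f a ≤ f b) (a : M) :
    {b | TwoSidedLE a b ∧ TwoSidedLE b a} = {b | f b = f a} :=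
  Set.ext fun b => by simp only [Set.mem_ofPred_eq, hf, le_antisymm_iff, and_comm]

theorem exists_orderIso_jCell {α : Type*} [PartialOrder α] {f : M → α}
    (hf : ∀ a b, TwoSidedLE a b ↔ f a ≤ f b) (hsurj : Function.Surjective f) :
    ∃ φ : JCell M ≃o α, ∀ (J : JCell M) (a : M), a ∈ J.1 → φ J = f a := by
  have hfibre (J : JCell M) : ∃ a : M, ∀ b, b ∈ J.1 ↔ f b = f a := by
    obtain ⟨a, ha⟩ := J.2
    exact ⟨a, fun b => by rw [ha, setOf_twoSidedLE_antisymm hf, Set.mem_ofPred_eq]⟩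
  choose rep mem_iff using hfibre
  have hbij : Function.Bijective fun J => f (rep J) := by
    refine ⟨fun J K hJK => Subtype.ext (Set.ext fun b => ?_), fun y => ?_⟩
    · rw [mem_iff, mem_iff]
      exact Eq.congr_right hJK
    · obtain ⟨a, rfl⟩ := hsurj y
      let J : JCell M := ⟨_, a, setOf_twoSidedLE_antisymm hf a |>.symm⟩
      exact ⟨J, ((mem_iff J a).1 rfl).symm⟩
  refine ⟨⟨Equiv.ofBijective _ hbij, fun {J K} => ⟨fun h => ?_, ?_⟩⟩,
    fun J a ha => ((mem_iff J a).1 ha).symm⟩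
  · exact ⟨rep J, (mem_iff J _).2 rfl, rep K, (mem_iff K _).2 rfl, (hf _ _).2 h⟩
  · rintro ⟨a, ha, b, hb, hab⟩
    change f (rep J) ≤ f (rep K)
    rw [← (mem_iff J a).1 ha, ← (mem_iff K b).1 hb]
    exact (hf a b).1 hab

end Monoid

section Star

variable {M : Type*} [Monoid M] [StarMul M]

theorem rightLE_iff_leftLE_star {a b : M} : RightLE a b ↔ LeftLE (star a) (star b) :=
  star_involutive.toPerm.exists_congr fun c => by simp [← star_mul]

theorem isRightCell_iff_isLeftCell_preimage_star {R : Set M} :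
    IsRightCell R ↔ IsLeftCell (star ⁻¹' R) := by
  refine star_involutive.toPerm.exists_congr fun a => ?_
  have hcell : {b : M | LeftLE (star a) b ∧ LeftLE b (star a)} =
      star ⁻¹' {b | RightLE a b ∧ RightLE b a} := by
    ext b
    simp only [Set.mem_preimage, Set.mem_ofPred_eq, rightLE_iff_leftLE_star, star_star]
  change R = _ ↔ star ⁻¹' R = {b : M | LeftLE (star a) b ∧ LeftLE b (star a)}
  rw [hcell, (Set.preimage_injective.2 star_involutive.surjective).eq_iff]

theorem ncard_preimage_star (R : Set M) : (star ⁻¹' R).ncard = R.ncard :=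
  Set.ncard_preimage_of_injective_subset_range star_injective
    fun x _ => star_involutive.surjective x

theorem ncard_rightCells_eq_ncard_leftCells {J : Set M} (hJ : star ⁻¹' J = J) :
    {R | IsRightCell R ∧ R ⊆ J}.ncard = {L | IsLeftCell L ∧ L ⊆ J}.ncard := by
  have hpre : {R : Set M | IsRightCell R ∧ R ⊆ J} =
      Set.preimage star ⁻¹' {L | IsLeftCell L ∧ L ⊆ J} := by
    ext R
    rw [Set.mem_preimage, Set.mem_ofPred_eq, Set.mem_ofPred_eq,
      isRightCell_iff_isLeftCell_preimage_star]
    conv_rhs => rw [← hJ, star_involutive.surjective.preimage_subset_preimage_iff]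
  rw [hpre]
  exact Set.ncard_preimage_of_injective_subset_range
    (Set.preimage_injective.2 star_involutive.surjective)
    fun L _ => ⟨star ⁻¹' L, by simp only [← Set.preimage_comp, star_involutive.comp_self,
      Set.preimage_id]⟩

end Star

theorem exists_subsemigroup_singleton {M : Type*} [Mul M] {e : M} (he : IsIdempotentElem e) :
    ∃ H : Subsemigroup M, (H : Set M) = {e} ∧ Nonempty (H ≃* Unit) := by
  let H : Subsemigroup M := ⟨{e}, by rintro _ _ rfl rfl; exact he⟩
  have : Unique H := ⟨⟨⟨e, rfl⟩⟩, fun x => Subtype.ext x.2⟩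
  exact ⟨H, rfl, ⟨MulEquiv.ofUnique⟩⟩

end GreenCell

namespace Motzkin

/-- The Motzkin triangle: the number of paths with `n` steps up, down or level that start at height
`0`, stay nonnegative and end at height `k`. -/
def motzkinTriangle : ℕ → ℕ → ℕ
  | 0, 0 => 1
  | 0, _ + 1 => 0
  | n + 1, 0 => motzkinTriangle n 0 + motzkinTriangle n 1
  | n + 1, k + 1 => motzkinTriangle n k + motzkinTriangle n (k + 1) + motzkinTriangle n (k + 2)

/-- The number of ballot sequences with `t` down-steps that end at height `k`. -/
def ballot (k t : ℕ) : ℚ := ((k : ℚ) + 1) / ((k : ℚ) + (t : ℚ) + 1) * ((k + 2 * t).choose t : ℚ)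

theorem ballot_zero (k : ℕ) : ballot k 0 = 1 := by
  have : (k : ℚ) + 1 ≠ 0 := by positivity
  simp [ballot, this]

theorem ballot_succ (k t : ℕ) :
    ballot k (t + 1) = (k + 2 * t + 2).choose (t + 1) - (k + 2 * t + 2).choose t := by
  have h := Nat.choose_succ_right_eq (k + 2 * t + 2) t
  rw [show k + 2 * t + 2 - t = k + t + 2 by omega] at h
  have h' : ((k + 2 * t + 2).choose (t + 1) : ℚ) * (t + 1) =
      (k + 2 * t + 2).choose t * (k + t + 2) := by exact_mod_cast h
  have hk : (k : ℚ) + (t + 1) + 1 ≠ 0 := by positivity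
  rw [ballot, show k + 2 * (t + 1) = k + 2 * t + 2 by ring]
  push_cast
  field_simp
  linear_combination -h'

theorem ballot_zero_succ (t : ℕ) : ballot 0 (t + 1) = ballot 1 t := by
  rw [ballot_succ]
  cases t with
  | zero => rw [ballot_zero]; norm_num [Nat.choose]
  | succ t =>
    rw [ballot_succ, show 0 + 2 * (t + 1) + 2 = (1 + 2 * t + 2) + 1 by ring,
      Nat.choose_succ_succ' (1 + 2 * t + 2) (t + 1), Nat.choose_succ_succ' (1 + 2 * t + 2) t]
    have := Nat.choose_symm_of_eq_add (n := 1 + 2 * t + 2) (a := t + 1 + 1) (b := t + 1) (by ring)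
    rw [this]
    push_cast
    ring

theorem ballot_succ_succ (k t : ℕ) :
    ballot (k + 1) (t + 1) = ballot k (t + 1) + ballot (k + 2) t := by
  rw [ballot_succ, ballot_succ]
  cases t with
  | zero =>
    simp only [ballot_zero, mul_zero, add_zero, zero_add, Nat.choose_one_right,
      Nat.choose_zero_right]
    push_cast
    ring
  | succ t =>
    rw [ballot_succ, show k + 1 + 2 * (t + 1) + 2 = (k + 2 * t + 4) + 1 by ring,
      show k + 2 * (t + 1) + 2 = k + 2 * t + 4 by ring,
      show k + 2 + 2 * t + 2 = k + 2 * t + 4 by ring,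
      Nat.choose_succ_succ' (k + 2 * t + 4) (t + 1), Nat.choose_succ_succ' (k + 2 * t + 4) t]
    push_cast
    ring

/-- The closed form of the Motzkin triangle: a Motzkin path with `t` down-steps is a ballot sequence
carried by the `k + 2 * t` steps that are not level. -/
def ballotSum (n k : ℕ) : ℚ :=
  ∑ t ∈ Finset.range (n + 1), (n.choose (k + 2 * t) : ℚ) * ballot k t

theorem ballotSum_eq_sum_range {n N : ℕ} (hN : n < N) (k : ℕ) :
    ballotSum n k = ∑ t ∈ Finset.range N, (n.choose (k + 2 * t) : ℚ) * ballot k t := by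
  refine Finset.sum_subset (Finset.range_subset_range.2 hN) fun t _ ht => ?_
  rw [Finset.mem_range] at ht
  rw [Nat.choose_eq_zero_of_lt (by omega), Nat.cast_zero, zero_mul]

theorem ballotSum_eq_add_sum_range {n N : ℕ} (hN : n < N) (k : ℕ) :
    ballotSum n k =
      ∑ t ∈ Finset.range N, (n.choose (k + 2 * t + 2) : ℚ) * ballot k (t + 1) + n.choose k := by
  rw [ballotSum_eq_sum_range (hN.trans N.lt_succ_self), Finset.sum_range_succ', ballot_zero,
    mul_one, mul_zero, add_zero]
  simp only [mul_add, mul_one, add_assoc]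

theorem ballotSum_succ_zero (n : ℕ) : ballotSum (n + 1) 0 = ballotSum n 0 + ballotSum n 1 := by
  have hn : n < n + 2 := by omega
  rw [ballotSum_eq_add_sum_range (Nat.lt_succ_self (n + 1)), ballotSum_eq_add_sum_range hn,
    ballotSum_eq_sum_range hn, add_right_comm, ← Finset.sum_add_distrib, Nat.choose_zero_right,
    Nat.choose_zero_right]
  congr 1
  refine Finset.sum_congr rfl fun t _ => ?_
  rw [ballot_zero_succ, Nat.choose_succ_succ' n (0 + 2 * t + 1),
    show 0 + 2 * t + 1 + 1 = 0 + 2 * t + 2 from rfl, show 0 + 2 * t + 1 = 1 + 2 * t by ring]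
  push_cast
  ring

theorem ballotSum_succ_succ (n k : ℕ) : ballotSum (n + 1) (k + 1) =
    ballotSum n k + ballotSum n (k + 1) + ballotSum n (k + 2) := by
  have hn : n < n + 2 := by omega
  rw [ballotSum_eq_add_sum_range (Nat.lt_succ_self (n + 1)), ballotSum_eq_add_sum_range hn,
    ballotSum_eq_add_sum_range hn, ballotSum_eq_sum_range hn, Nat.choose_succ_succ',
    add_add_add_comm, add_right_comm, ← Finset.sum_add_distrib, ← Finset.sum_add_distrib,
    Nat.cast_add]
  congr 1
  refine Finset.sum_congr rfl fun t _ => ?_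
  rw [ballot_succ_succ, Nat.choose_succ_succ' n (k + 1 + 2 * t + 1),
    show k + 1 + 2 * t + 1 + 1 = k + 1 + 2 * t + 2 from rfl,
    show k + 1 + 2 * t + 1 = k + 2 * t + 2 by ring,
    show k + 2 + 2 * t = k + 2 * t + 2 by ring]
  push_cast
  ring

theorem motzkinTriangle_eq_ballotSum (n k : ℕ) : (motzkinTriangle n k : ℚ) = ballotSum n k := by
  induction n, k using motzkinTriangle.induct with
  | case1 => simp [motzkinTriangle, ballotSum, ballot_zero]
  | case2 => simp [motzkinTriangle, ballotSum]
  | case3 n ih₀ ih₁ => rw [motzkinTriangle, ballotSum_succ_zero, Nat.cast_add, ih₀, ih₁]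
  | case4 n k ih₀ ih₁ ih₂ =>
    rw [motzkinTriangle, ballotSum_succ_succ, Nat.cast_add, Nat.cast_add, ih₀, ih₁, ih₂]

/-- A half diagram on the points `0, …, n - 1`, encoded by the partner function `h`: `h x = some y`
if `x` is joined to `y`, `h x = some x` if `x` is isolated, and `h x = none` if `x` is a defect,
the end of a through strand. The points from `n` on count as isolated, so that a half diagram on
`n` points is also one on `n + 1` points. -/
structure IsHalf (n : ℕ) (h : ℕ → Option ℕ) : Prop where
  symm : ∀ {x y}, h x = some y → h y = some x
  isolated : ∀ {x}, n ≤ x → h x = some x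
  nested : ∀ {w x y}, h w = some y → w < x → x < y → ∃ z < y, h x = some z

/-- The points of a half diagram at which a through strand ends. -/
def defects (h : ℕ → Option ℕ) : Set ℕ := {x | h x = none}

/-- The half diagrams on `n` points with `k` defects. -/
def halves (n k : ℕ) : Set (ℕ → Option ℕ) := {h | IsHalf n h ∧ (defects h).ncard = k}

namespace IsHalf

variable {n : ℕ} {h : ℕ → Option ℕ}

theorem lt_of_mem_defects (hh : IsHalf n h) {x : ℕ} (hx : x ∈ defects h) : x < n := by
  by_contra! hnx
  exact Option.some_ne_none x ((hh.isolated hnx).symm.trans hx)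

theorem finite_defects (hh : IsHalf n h) : (defects h).Finite :=
  (Set.finite_Iio n).subset fun _ => hh.lt_of_mem_defects

theorem lt_of_eq_some (hh : IsHalf n h) {x y : ℕ} (hxy : h x = some y) (hx : x < n) : y < n := by
  by_contra! hny
  have := (hh.isolated hny).symm.trans (hh.symm hxy)
  grind

theorem succ_of_isolated (hh : IsHalf n h) : IsHalf (n + 1) h :=
  ⟨hh.symm, fun hx => hh.isolated (Nat.le_of_succ_le hx), hh.nested⟩

end IsHalf

/-- Adding the point `n` to a half diagram on `n` points, as a defect. -/
def addDefect (n : ℕ) (h : ℕ → Option ℕ) (x : ℕ) : Option ℕ := Function.update h n none x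

/-- Adding the point `n` to a half diagram on `n` points, joined to the last defect. -/
noncomputable def addArc (n : ℕ) (h : ℕ → Option ℕ) (x : ℕ) : Option ℕ :=
  Function.update (Function.update h (sSup (defects h)) (some n)) n (some (sSup (defects h))) x

/-- Deleting the last point `n` from a half diagram on `n + 1` points. Its partner, if there is one,
becomes a defect. -/
def deleteLast (n : ℕ) (h : ℕ → Option ℕ) (x : ℕ) : Option ℕ :=
  if x = n then some n else if h x = some n then none else h x

section LastPoint

variable {n k : ℕ} {h : ℕ → Option ℕ}

theorem isHalf_addDefect (hh : IsHalf n h) : IsHalf (n + 1) (addDefect n h) where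
  symm {x y} hxy := by
    have := hh.symm (x := x) (y := y)
    have := hh.isolated le_rfl
    grind [addDefect]
  isolated {x} hx := by
    have := hh.isolated (Nat.le_of_succ_le hx)
    grind [addDefect]
  nested {w x y} hwy hwx hxy := by
    have := hh.nested (w := w) (x := x) (y := y)
    have := hh.symm (x := w) (y := y)
    have := hh.isolated (x := y)
    grind [addDefect]

theorem defects_addDefect : defects (addDefect n h) = insert n (defects h) := by
  ext x
  simp only [defects, addDefect, Set.mem_ofPred_eq, Set.mem_insert_iff, Function.update_apply]
  split_ifs with hx <;> simp [hx]

theorem IsHalf.isGreatest_sSup_defects (hh : IsHalf n h) (hne : (defects h).Nonempty) :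
    IsGreatest (defects h) (sSup (defects h)) :=
  ⟨hne.csSup_mem hh.finite_defects, fun _ hx => le_csSup hh.finite_defects.bddAbove hx⟩

theorem isHalf_addArc (hh : IsHalf n h) (hne : (defects h).Nonempty) :
    IsHalf (n + 1) (addArc n h) := by
  obtain ⟨hm, hmax⟩ := hh.isGreatest_sSup_defects hne
  have hmn := hh.lt_of_mem_defects hm
  have hlast := hh.isolated le_rfl
  unfold addArc
  generalize sSup (defects h) = m at *
  replace hm : h m = none := hm
  refine ⟨fun {x y} hxy => ?_, fun {x} hx => ?_, fun {w x y} hwy hwx hxy => ?_⟩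
  · have := hh.symm (x := x) (y := y)
    grind
  · have := hh.isolated (Nat.le_of_succ_le hx)
    grind
  · have hnested := hh.nested (w := w) (x := x) (y := y)
    have := hh.symm (x := w) (y := y)
    have := hh.isolated (x := y)
    by_cases hw : w = m
    · obtain ⟨z, hz⟩ : ∃ z, h x = some z :=
        Option.ne_none_iff_exists'.1 fun hx => (hmax hx).not_gt (hw ▸ hwx)
      have := hh.lt_of_eq_some hz
      grind
    · grind

theorem defects_addArc (hh : IsHalf n h) :
    defects (addArc n h) = defects h \ {sSup (defects h)} := by
  ext x
  have := hh.isolated le_rfl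
  simp only [defects, addArc, Set.mem_ofPred_eq, Set.mem_sdiff, Set.mem_singleton_iff,
    Function.update_apply]
  grind

theorem isHalf_deleteLast (hh : IsHalf (n + 1) h) : IsHalf n (deleteLast n h) where
  symm {x y} hxy := by
    have := hh.symm (x := x) (y := y)
    have := hh.symm (x := y) (y := n)
    grind [deleteLast]
  isolated {x} hx := by
    have := hh.isolated (x := x)
    grind [deleteLast]
  nested {w x y} hwy hwx hxy := by
    have := hh.nested (w := w) (x := x) (y := y)
    have := hh.lt_of_eq_some (x := w) (y := y)
    have := hh.symm (x := w) (y := y)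
    have := hh.isolated (x := y)
    have := hh.symm (x := x) (y := n)
    grind [deleteLast]

theorem deleteLast_addDefect (hh : IsHalf n h) :
    deleteLast n (addDefect n h) = h := by
  funext x
  have := hh.isolated le_rfl
  have := hh.symm (x := x) (y := n)
  grind [deleteLast, addDefect]

theorem addDefect_deleteLast (hh : IsHalf (n + 1) h) (hn : h n = none) :
    addDefect n (deleteLast n h) = h := by
  funext x
  have := hh.symm (x := x) (y := n)
  grind [deleteLast, addDefect]

theorem deleteLast_addArc (hh : IsHalf n h) (hne : (defects h).Nonempty) :
    deleteLast n (addArc n h) = h := by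
  obtain ⟨hm : h _ = none, -⟩ := hh.isGreatest_sSup_defects hne
  funext x
  have := hh.isolated le_rfl
  have := hh.symm (x := x) (y := n)
  grind [deleteLast, addArc]

theorem defects_deleteLast (hh : IsHalf (n + 1) h) {m : ℕ} (hmn : m < n)
    (hm : h n = some m) : defects (deleteLast n h) = insert m (defects h) := by
  ext x
  have := hh.symm hm
  have := hh.symm (x := x) (y := n)
  simp only [defects, deleteLast, Set.mem_ofPred_eq, Set.mem_insert_iff]
  grind

theorem addArc_deleteLast (hh : IsHalf (n + 1) h) {m : ℕ} (hmn : m < n)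
    (hm : h n = some m) : addArc n (deleteLast n h) = h := by
  have hlast : sSup (defects (deleteLast n h)) = m := by
    rw [defects_deleteLast hh hmn hm]
    refine IsGreatest.csSup_eq ⟨Set.mem_insert _ _, ?_⟩
    rintro x (rfl | (hx : h x = none))
    · exact le_rfl
    · by_contra! hmx
      have := hh.nested (x := x) (hh.symm hm) hmx
      have := hh.lt_of_mem_defects hx
      grind
  funext x
  have := hh.symm hm
  have := hh.symm (x := x) (y := n)
  grind [deleteLast, addArc]

theorem bijOn_addDefect (n k : ℕ) :
    Set.BijOn (addDefect n) (halves n k) {h ∈ halves (n + 1) (k + 1) | h n = none} := by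
  refine Set.InvOn.bijOn (f' := deleteLast n) ⟨fun h hh => deleteLast_addDefect hh.1,
    fun h hh => addDefect_deleteLast hh.1.1 hh.2⟩ ?_ ?_
  · rintro h ⟨hh, rfl⟩
    refine ⟨⟨isHalf_addDefect hh, ?_⟩, Function.update_self ..⟩
    rw [defects_addDefect, Set.ncard_insert_of_notMem (fun hn => (hh.lt_of_mem_defects hn).false)
      hh.finite_defects]
  · rintro h ⟨⟨hh, hk⟩, hn⟩
    have hh' := isHalf_deleteLast hh
    refine ⟨hh', ?_⟩
    rw [← addDefect_deleteLast hh hn, defects_addDefect, Set.ncard_insert_of_notMem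
      (fun hn => (hh'.lt_of_mem_defects hn).false) hh'.finite_defects] at hk
    exact Nat.succ_injective hk

theorem bijOn_addArc (n k : ℕ) :
    Set.BijOn (addArc n) (halves n (k + 1)) {h ∈ halves (n + 1) k | ∃ m < n, h n = some m} := by
  have hne {h : ℕ → Option ℕ} (hh : h ∈ halves n (k + 1)) : (defects h).Nonempty :=
    Set.nonempty_of_ncard_ne_zero (hh.2 ▸ k.succ_ne_zero)
  refine Set.InvOn.bijOn (f' := deleteLast n) ⟨fun h hh => deleteLast_addArc hh.1 (hne hh),
    fun h hh => hh.2.elim fun m hm => addArc_deleteLast hh.1.1 hm.1 hm.2⟩ ?_ ?_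
  · intro h hh
    have hm := (hh.1.isGreatest_sSup_defects (hne hh)).1
    refine ⟨⟨isHalf_addArc hh.1 (hne hh), ?_⟩, _, hh.1.lt_of_mem_defects hm,
      Function.update_self ..⟩
    rw [defects_addArc hh.1, Set.ncard_sdiff_singleton_of_mem hm, hh.2, Nat.add_sub_cancel]
  · rintro h ⟨⟨hh, rfl⟩, m, hmn, hm⟩
    refine ⟨isHalf_deleteLast hh, ?_⟩
    rw [defects_deleteLast hh hmn hm, Set.ncard_insert_of_notMem _ hh.finite_defects]
    exact fun hm' : h m = none => Option.some_ne_none n ((hh.symm hm).symm.trans hm')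

theorem halves_succ_sep_isolated (n k : ℕ) :
    {h ∈ halves (n + 1) k | h n = some n} = halves n k := by
  ext h
  constructor
  · rintro ⟨⟨hh, hk⟩, hn⟩
    refine ⟨⟨hh.symm, fun {x} hx => ?_, hh.nested⟩, hk⟩
    obtain rfl | hx := hx.eq_or_lt
    · exact hn
    · exact hh.isolated hx
  · exact fun hh => ⟨⟨hh.1.succ_of_isolated, hh.2⟩, hh.1.isolated le_rfl⟩

theorem encard_halves_succ (n k : ℕ) : (halves (n + 1) k).encard =
    {h ∈ halves (n + 1) k | h n = none}.encard + (halves n k).encard +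
      (halves n (k + 1)).encard := by
  rw [Set.encard_congr ((bijOn_addArc n k).equiv _), ← halves_succ_sep_isolated n k,
    ← Set.encard_union_eq, ← Set.encard_union_eq]
  · congr 1
    ext h
    have (hh : h ∈ halves (n + 1) k) : h n = none ∨ h n = some n ∨ ∃ m < n, h n = some m := by
      obtain hn | ⟨m, hm⟩ := Option.eq_none_or_eq_some (h n)
      · exact Or.inl hn
      · have := hh.1.lt_of_eq_some hm n.lt_succ_self
        grind
    grind
  · exact Set.disjoint_left.2 (by grind)
  · exact Set.disjoint_left.2 (by grind)

theorem halves_zero_sep_eq_empty (n : ℕ) : {h ∈ halves (n + 1) 0 | h n = none} = ∅ := by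
  refine Set.eq_empty_of_forall_notMem fun h hh => ?_
  have := (Set.ncard_eq_zero hh.1.1.finite_defects).1 hh.1.2
  exact Set.notMem_empty n (this ▸ hh.2)

theorem isHalf_zero_iff : IsHalf 0 h ↔ h = some :=
  ⟨fun hh => funext fun x => hh.isolated x.zero_le, by rintro rfl; constructor <;> grind⟩

theorem encard_halves (n k : ℕ) : (halves n k).encard = motzkinTriangle n k := by
  have hsome : defects some = ∅ := Set.eq_empty_of_forall_notMem fun x => Option.some_ne_none x
  induction n, k using motzkinTriangle.induct with
  | case1 =>
    rw [motzkinTriangle, Nat.cast_one, Set.encard_eq_one]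
    exact ⟨some, by ext h; simp +contextual [halves, isHalf_zero_iff, hsome]⟩
  | case2 k =>
    rw [motzkinTriangle, Nat.cast_zero, Set.encard_eq_zero]
    ext h
    simp +contextual [halves, isHalf_zero_iff, hsome]
  | case3 n ih₀ ih₁ =>
    rw [motzkinTriangle, encard_halves_succ, halves_zero_sep_eq_empty, Set.encard_empty, zero_add,
      ih₀, ih₁, Nat.cast_add]
  | case4 n k ih₀ ih₁ ih₂ =>
    rw [motzkinTriangle, encard_halves_succ, ← Set.encard_congr ((bijOn_addDefect n k).equiv _),
      ih₀, ih₁, ih₂, Nat.cast_add, Nat.cast_add]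

theorem ncard_halves (n k : ℕ) : (halves n k).ncard = motzkinTriangle n k := by
  rw [Set.ncard, encard_halves, ENat.toNat_natCast]

end LastPoint

/-- The half diagram without arcs whose set of defects is `S`. -/
noncomputable def arclessHalf (S : Set ℕ) (x : ℕ) : Option ℕ :=
  open Classical in if x ∈ S then none else some x

theorem defects_arclessHalf (S : Set ℕ) : defects (arclessHalf S) = S :=
  Set.ext fun x => by simp [defects, arclessHalf]

theorem isHalf_arclessHalf {n : ℕ} {S : Set ℕ} (hS : S ⊆ Set.Iio n) : IsHalf n (arclessHalf S) where
  symm {x y} hxy := by grind [arclessHalf]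
  isolated {x} hx := if_neg fun hxS => (hS hxS).not_ge hx
  nested {w x y} hwy := by grind [arclessHalf]

theorem arclessHalf_mem_halves {n : ℕ} {S : Set ℕ} (hS : S ⊆ Set.Iio n) :
    arclessHalf S ∈ halves n S.ncard :=
  ⟨isHalf_arclessHalf hS, by rw [defects_arclessHalf]⟩

theorem pos_swap {n : ℕ} (u : Node n) : pos u.swap = 2 * n - 1 - pos u := by
  rcases u with i | i
  · rfl
  · simp only [pos, Sum.swap_inr]
    omega

theorem swap_eq_iff {n : ℕ} {u v : Node n} : u.swap = v ↔ u = v.swap :=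
  ((Equiv.sumComm _ _).eq_symm_apply).symm

namespace Diagram

section Partner

variable {n : ℕ} {a b : Diagram n} {u v : Node n}

/-- Reflection in the horizontal axis. -/
instance : Star (Diagram n) where
  star a :=
    { rel := flip a.rel
      card_le_two := by
        intro x y z hxy hxz
        have := a.card_le_two _ _ _ hxy hxz
        simpa only [Sum.swap_leftInverse.injective.eq_iff] using this
      crossingless := by
        intro w x y z hwx hxy hyz hwy hxz
        have hz := pos_lt z
        refine a.crossingless z.swap y.swap x.swap w.swap ?_ ?_ ?_ (a.rel.symm hxz)
          (a.rel.symm hwy) <;> simp only [pos_swap] <;> omega }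

instance : StarMul (Diagram n) where
  star_involutive a := Diagram.ext (flip_flip a.rel)
  star_mul a b := Diagram.ext (stackRel_flip a.rel b.rel).symm

theorem star_rel : (star a).rel u v ↔ a.rel u.swap v.swap := Iff.rfl

open Classical in
/-- The other node of the block of `u`, or `u` itself if its block is a singleton. -/
noncomputable def partner (a : Diagram n) (u : Node n) : Node n :=
  if h : ∃ v, v ≠ u ∧ a.rel u v then h.choose else u

theorem rel_iff : a.rel u v ↔ v = u ∨ v = a.partner u := by
  unfold partner
  split_ifs with h
  · obtain ⟨hne, hrel⟩ := h.choose_spec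
    refine ⟨fun huv => ?_, ?_⟩
    · have := a.card_le_two u v _ huv hrel
      grind
    · rintro (rfl | rfl)
      exacts [a.rel.refl _, hrel]
  · refine ⟨fun huv => ?_, ?_⟩
    · grind
    · rintro (rfl | rfl) <;> exact a.rel.refl _

theorem partner_eq_iff : a.partner u = v ↔ ∀ w, a.rel u w ↔ w = u ∨ w = v := by
  refine ⟨fun h w => h ▸ rel_iff, fun h => ?_⟩
  have hu := (h (a.partner u)).1 (rel_iff.2 (Or.inr rfl))
  have hv := rel_iff.1 ((h v).2 (Or.inr rfl))
  grind

theorem partner_partner (a : Diagram n) (u : Node n) : a.partner (a.partner u) = u := by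
  have hu : a.rel u (a.partner u) := rel_iff.2 (Or.inr rfl)
  refine partner_eq_iff.2 fun w => ?_
  rw [Or.comm, ← rel_iff]
  exact ⟨a.rel.trans hu, a.rel.trans (a.rel.symm hu)⟩

theorem partner_eq_comm : a.partner u = v ↔ a.partner v = u :=
  ⟨fun h => h ▸ a.partner_partner u, fun h => h ▸ a.partner_partner v⟩

theorem partner_star : (star a).partner u = (a.partner u.swap).swap :=
  partner_eq_iff.2 fun w => by
    rw [star_rel, rel_iff, Sum.swap_leftInverse.injective.eq_iff, swap_eq_iff]

theorem pos_partner_lt {x : Node n} (hux : pos u < pos x) (hxu : pos x < pos (a.partner u)) :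
    pos (a.partner x) < pos (a.partner u) := by
  refine lt_of_le_of_ne (not_lt.1 fun h => ?_) fun h => ?_
  · exact a.crossingless u x _ _ hux hxu h (rel_iff.2 (Or.inr rfl)) (rel_iff.2 (Or.inr rfl))
  · rw [← a.partner_partner x, pos_injective h, partner_partner] at hux
    exact hux.false

end Partner

section Halves

variable {n : ℕ} {a b : Diagram n}

/-- The bottom half of a diagram, obtained by cutting the through strands. -/
noncomputable def bottom (a : Diagram n) (x : ℕ) : Option ℕ :=
  if hx : x < n then Sum.elim (fun i => some i.1) (fun _ => none) (a.partner (.inl ⟨x, hx⟩))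
  else some x

/-- The top half of a diagram, obtained by cutting the through strands. -/
noncomputable def top (a : Diagram n) : ℕ → Option ℕ := (star a).bottom

theorem bottom_star : (star a).bottom = a.top := rfl

theorem top_star : (star a).top = a.bottom := by rw [top, star_star]

theorem bottom_of_le {x : ℕ} (hx : n ≤ x) : a.bottom x = some x := dif_neg hx.not_gt

theorem bottom_eq_some_iff_exists {i : Fin n} {y : ℕ} :
    a.bottom i = some y ↔ ∃ j : Fin n, a.partner (.inl i) = .inl j ∧ ↑j = y := by
  rw [bottom, dif_pos i.2]
  rcases a.partner (.inl i) with m | m <;> simp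

theorem bottom_eq_some_iff {i j : Fin n} :
    a.bottom i = some ↑j ↔ a.partner (.inl i) = .inl j := by
  simp only [bottom_eq_some_iff_exists, Fin.val_inj, exists_eq_right]

theorem mem_defects_bottom {i : Fin n} :
    ↑i ∈ defects a.bottom ↔ ∃ j, a.partner (.inl i) = .inr j := by
  rw [defects, Set.mem_ofPred_eq, bottom, dif_pos i.2]
  rcases a.partner (.inl i) with m | m <;> simp

theorem top_eq_some_iff {i j : Fin n} : a.top i = some ↑j ↔ a.partner (.inr i) = .inr j := by
  rw [top, bottom_eq_some_iff, partner_star, swap_eq_iff, Sum.swap_inl, Sum.swap_inl]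

theorem mem_defects_top {j : Fin n} : ↑j ∈ defects a.top ↔ ∃ i, a.partner (.inl i) = .inr j := by
  simp only [top, mem_defects_bottom, partner_star, swap_eq_iff, Sum.swap_inl,
    Sum.swap_inr, partner_eq_comm (u := .inr j)]

theorem isHalf_bottom (a : Diagram n) : IsHalf n a.bottom where
  symm {x y} hxy := by
    by_cases hx : x < n
    · lift x to Fin n using hx
      obtain ⟨j, hj, rfl⟩ := bottom_eq_some_iff_exists.1 hxy
      exact bottom_eq_some_iff.2 (partner_eq_comm.1 hj)
    · rw [bottom_of_le (not_lt.1 hx), Option.some_inj] at hxy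
      rw [← hxy, bottom_of_le (not_lt.1 hx)]
  isolated := bottom_of_le
  nested {w x y} hwy hwx hxy := by
    have hw : w < n := by
      by_contra! hw
      have := (bottom_of_le (a := a) hw).symm.trans hwy
      grind
    lift w to Fin n using hw
    obtain ⟨j, hj, rfl⟩ := bottom_eq_some_iff_exists.1 hwy
    lift x to Fin n using hxy.trans j.2
    have hlt := pos_partner_lt (a := a) (u := .inl w) (x := .inl x) hwx (by rwa [hj])
    rw [hj] at hlt
    rcases hp : a.partner (.inl x) with z | z <;> rw [hp] at hlt <;> simp only [pos] at hlt
    · exact ⟨z, hlt, bottom_eq_some_iff.2 hp⟩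
    · omega

theorem isHalf_top (a : Diagram n) : IsHalf n a.top := (star a).isHalf_bottom

theorem ncard_defects_bottom (a : Diagram n) : (defects a.bottom).ncard = a.throughStrands := by
  refine (Set.ncard_congr (fun p _ => (p.1 : ℕ)) (fun p hp => ?_) (fun p q hp hq hpq => ?_)
    fun x hx => ?_).symm
  · exact mem_defects_bottom.2 ⟨p.2, ((rel_iff.1 hp).resolve_left Sum.inr_ne_inl).symm⟩
  · have hp' := (rel_iff.1 hp).resolve_left Sum.inr_ne_inl
    have hq' := (rel_iff.1 hq).resolve_left Sum.inr_ne_inl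
    have hfst : p.1 = q.1 := Fin.ext hpq
    exact Prod.ext hfst (Sum.inr_injective (by rw [hp', hq', hfst]))
  · have := a.isHalf_bottom.lt_of_mem_defects hx
    lift x to Fin n using this
    obtain ⟨j, hj⟩ := mem_defects_bottom.1 hx
    exact ⟨(x, j), rel_iff.2 (Or.inr hj.symm), rfl⟩

end Halves

end Diagram

section Gluing

variable {n : ℕ} {h h' : ℕ → Option ℕ}

/-- The relation on the nodes that joins two half diagrams, `h` at the bottom and `h'` at the top,
along a bijection of their defects. -/
def glueLink (e : defects h ≃o defects h') : Node n → Node n → Prop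
  | .inl i, .inl j => h i = some ↑j
  | .inr i, .inr j => h' i = some ↑j
  | .inl i, .inr j => ∃ hi : ↑i ∈ defects h, (e ⟨i, hi⟩ : ℕ) = j
  | .inr j, .inl i => ∃ hi : ↑i ∈ defects h, (e ⟨i, hi⟩ : ℕ) = j

variable {e : defects h ≃o defects h'} {u v w : Node n}

theorem glueLink_symm (hh : IsHalf n h) (hh' : IsHalf n h') (huv : glueLink e u v) :
    glueLink e v u := by
  rcases u with i | i <;> rcases v with j | j
  exacts [hh.symm huv, huv, huv, hh'.symm huv]

theorem glueLink_swap : glueLink e u.swap v.swap ↔ glueLink e.symm u v := by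
  have hthrough (i j : Fin n) : (∃ hi : ↑i ∈ defects h, (e ⟨i, hi⟩ : ℕ) = j) ↔
      ∃ hj : ↑j ∈ defects h', (e.symm ⟨j, hj⟩ : ℕ) = i := by
    constructor
    · rintro ⟨hi, hij⟩
      have hj : ↑j ∈ defects h' := hij ▸ (e ⟨i, hi⟩).2
      exact ⟨hj, by rw [← Subtype.ext (a1 := e ⟨i, hi⟩) (a2 := ⟨j, hj⟩) hij, e.symm_apply_apply]⟩
    · rintro ⟨hj, hij⟩
      have hi : ↑i ∈ defects h := hij ▸ (e.symm ⟨j, hj⟩).2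
      exact ⟨hi, by
        rw [← Subtype.ext (a1 := e.symm ⟨j, hj⟩) (a2 := ⟨i, hi⟩) hij, e.apply_symm_apply]⟩
  rcases u with i | i <;> rcases v with j | j
  exacts [Iff.rfl, hthrough j i, hthrough i j, Iff.rfl]

theorem glueLink_unique (huv : glueLink e u v) (huw : glueLink e u w) : v = w := by
  have hbottom {h h' : ℕ → Option ℕ} (e : defects h ≃o defects h') {i : Fin n} {v w : Node n}
      (hv : glueLink e (.inl i) v) (hw : glueLink e (.inl i) w) : v = w := by
    rcases v with j | j <;> rcases w with m | m
    · exact congrArg _ (Fin.ext (Option.some_inj.1 (hv.symm.trans hw)))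
    · exact absurd (hv.symm.trans hw.1) (Option.some_ne_none _)
    · exact absurd (hw.symm.trans hv.1) (Option.some_ne_none _)
    · exact congrArg _ (Fin.ext (hv.2.symm.trans hw.2))
  rcases u with i | i
  · exact hbottom e huv huw
  · rw [← v.swap_swap, ← w.swap_swap]
    exact congrArg _ (hbottom e.symm (glueLink_swap.1 (by rwa [v.swap_swap]))
      (glueLink_swap.1 (by rwa [w.swap_swap])))

theorem glueLink_not_crossing (hh : IsHalf n h) (hh' : IsHalf n h') {x y : Node n}
    (hux : pos u < pos x) (hxv : pos x < pos v) (hvy : pos v < pos y) (huv : glueLink e u v) :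
    ¬glueLink e x y := by
  intro hxy
  rcases u with i | i <;> rcases x with p | p <;> rcases v with j | j <;> rcases y with q | q <;>
    simp only [pos] at hux hxv hvy <;> simp only [glueLink] at huv hxy <;> try omega
  · obtain ⟨z, hz, hpz⟩ := hh.nested huv hux hxv
    grind
  · obtain ⟨z, -, hpz⟩ := hh.nested huv hux hxv
    exact Option.some_ne_none _ (hpz.symm.trans hxy.1)
  · obtain ⟨hi, hij⟩ := huv
    obtain ⟨hp, hpq⟩ := hxy
    have hmono : (e ⟨i, hi⟩ : ℕ) < e ⟨p, hp⟩ := e.strictMono hux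
    omega
  · obtain ⟨hi, hij⟩ := huv
    obtain ⟨z, -, hjz⟩ := hh'.nested (hh'.symm hxy) (x := j) (by omega) (by omega)
    have hj : ↑j ∈ defects h' := hij ▸ (e ⟨i, hi⟩).2
    exact Option.some_ne_none _ (hjz.symm.trans hj)
  · obtain ⟨z, hz, hjz⟩ := hh'.nested (hh'.symm hxy) (x := j) (by omega) (by omega)
    have := hh'.symm huv
    grind

/-- The diagram with bottom half `h` and top half `h'` whose through strands are given by `e`. -/
def ofHalves (hh : IsHalf n h) (hh' : IsHalf n h') (e : defects h ≃o defects h') : Diagram n where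
  rel :=
    { r u v := u = v ∨ glueLink e u v
      iseqv :=
        { refl u := Or.inl rfl
          symm := Or.imp Eq.symm (glueLink_symm hh hh')
          trans := by
            rintro u v w (rfl | huv) (rfl | hvw)
            exacts [Or.inl rfl, Or.inr hvw, Or.inr huv,
              Or.inl (glueLink_unique (glueLink_symm hh hh' huv) hvw)] } }
  card_le_two := by
    rintro u v w (huv | huv) (huw | huw)
    exacts [Or.inl huv, Or.inl huv, Or.inr (Or.inl huw),
      Or.inr (Or.inr (glueLink_unique huv huw))]
  crossingless := by
    rintro u x v y hux hxv hvy (rfl | huv) (rfl | hxy)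
    · omega
    · omega
    · omega
    · exact glueLink_not_crossing hh hh' hux hxv hvy huv hxy

theorem partner_ofHalves (hh : IsHalf n h) (hh' : IsHalf n h') (huv : glueLink e u v) :
    (ofHalves hh hh' e).partner u = v :=
  Diagram.partner_eq_iff.2 fun _ => or_congr eq_comm
    ⟨fun huw => glueLink_unique huw huv, fun hwv => hwv ▸ huv⟩

theorem star_ofHalves (hh : IsHalf n h) (hh' : IsHalf n h') (e : defects h ≃o defects h') :
    star (ofHalves hh hh' e) = ofHalves hh' hh e.symm := by
  refine Diagram.ext (Setoid.ext fun u v => or_congr ?_ glueLink_swap)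
  exact Sum.swap_leftInverse.injective.eq_iff

theorem bottom_ofHalves (hh : IsHalf n h) (hh' : IsHalf n h') (e : defects h ≃o defects h') :
    (ofHalves hh hh' e).bottom = h := by
  funext x
  by_cases hx : x < n
  · rcases hhx : h x with _ | y
    · let y := e ⟨x, hhx⟩
      refine Diagram.mem_defects_bottom (i := ⟨x, hx⟩).2
        ⟨⟨y, hh'.lt_of_mem_defects y.2⟩, partner_ofHalves hh hh' ⟨hhx, rfl⟩⟩
    · exact Diagram.bottom_eq_some_iff (i := ⟨x, hx⟩) (j := ⟨y, hh.lt_of_eq_some hhx hx⟩).2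
        (partner_ofHalves hh hh' hhx)
  · rw [Diagram.bottom_of_le (not_lt.1 hx), hh.isolated (not_lt.1 hx)]

theorem top_ofHalves (hh : IsHalf n h) (hh' : IsHalf n h') (e : defects h ≃o defects h') :
    (ofHalves hh hh' e).top = h' := by
  rw [← Diagram.bottom_star, star_ofHalves, bottom_ofHalves]

end Gluing

namespace Diagram

section Reconstruction

variable {n : ℕ} {a b : Diagram n}

theorem exists_orderIso_defects (a : Diagram n) : ∃ e : defects a.bottom ≃o defects a.top,
    ∀ {i : Fin n} (hi : ↑i ∈ defects a.bottom) {j : Fin n},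
      (e ⟨i, hi⟩ : ℕ) = j ↔ a.partner (.inl i) = .inr j := by
  let i (x : defects a.bottom) : Fin n := ⟨x, a.isHalf_bottom.lt_of_mem_defects x.2⟩
  have hlink (x : defects a.bottom) : ∃ j, a.partner (.inl (i x)) = .inr j :=
    mem_defects_bottom.1 x.2
  choose j hij using hlink
  let f (x : defects a.bottom) : defects a.top := ⟨j x, mem_defects_top.2 ⟨i x, hij x⟩⟩
  have hmono : StrictMono f := fun x y hxy => by
    have hlt := pos_partner_lt (a := a) (u := .inl (i x)) (x := .inl (i y)) hxy
      (by rw [hij]; simp only [pos]; omega)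
    rw [hij, hij] at hlt
    change (j x : ℕ) < j y
    simp only [pos] at hlt
    omega
  have hsurj : Function.Surjective f := by
    rintro ⟨y, hy⟩
    lift y to Fin n using a.isHalf_top.lt_of_mem_defects hy
    obtain ⟨x, hx⟩ := mem_defects_top.1 hy
    have hx' : ↑x ∈ defects a.bottom := mem_defects_bottom.2 ⟨y, hx⟩
    have hy' : j ⟨x, hx'⟩ = y := Sum.inr_injective ((hij ⟨x, hx'⟩).symm.trans hx)
    exact ⟨⟨x, hx'⟩, Subtype.ext (congrArg Fin.val hy')⟩
  refine ⟨hmono.orderIsoOfSurjective _ hsurj, fun {x} hx {y} => ?_⟩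
  have hxy : a.partner (.inl x) = .inr (j ⟨x, hx⟩) := hij ⟨x, hx⟩
  rw [hxy, Sum.inr.injEq, Fin.ext_iff]
  rfl

theorem exists_ofHalves_eq (a : Diagram n) : ∃ e, ofHalves a.isHalf_bottom a.isHalf_top e = a := by
  obtain ⟨e, he⟩ := a.exists_orderIso_defects
  have hthrough (i j : Fin n) : (∃ hi : ↑i ∈ defects a.bottom, (e ⟨i, hi⟩ : ℕ) = j) ↔
      a.partner (.inl i) = .inr j :=
    ⟨fun ⟨hi, hij⟩ => (he hi).1 hij,
      fun hij => ⟨mem_defects_bottom.2 ⟨j, hij⟩, (he _).2 hij⟩⟩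
  refine ⟨e, Diagram.ext (Setoid.ext fun u v => ?_)⟩
  suffices glueLink e u v ↔ a.partner u = v by
    rw [rel_iff (a := a), eq_comm (a := v), eq_comm (a := v)]
    exact or_congr Iff.rfl this
  rcases u with i | i <;> rcases v with j | j
  · exact bottom_eq_some_iff
  · exact hthrough i j
  · exact (hthrough j i).trans partner_eq_comm
  · exact top_eq_some_iff

theorem eq_of_bottom_eq_of_top_eq (hbot : a.bottom = b.bottom) (htop : a.top = b.top) : a = b := by
  obtain ⟨e, he⟩ := a.exists_ofHalves_eq
  obtain ⟨f, hf⟩ := b.exists_ofHalves_eq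
  generalize_proofs ha ha' at he
  rw [← he, ← hf]
  clear he hf
  revert e ha ha'
  rw [hbot, htop]
  intro e _ _
  have := OrderIso.subsingleton_of_wellFoundedLT (α := defects b.bottom) (β := defects b.top)
  rw [Subsingleton.elim e f]

theorem throughStrands_star (a : Diagram n) : (star a).throughStrands = a.throughStrands := by
  obtain ⟨e, -⟩ := a.exists_orderIso_defects
  rw [← ncard_defects_bottom, ← ncard_defects_bottom]
  exact (Nat.card_congr e.toEquiv).symm

theorem bottom_mem_halves (a : Diagram n) : a.bottom ∈ halves n a.throughStrands :=
  ⟨a.isHalf_bottom, a.ncard_defects_bottom⟩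

theorem top_mem_halves (a : Diagram n) : a.top ∈ halves n a.throughStrands := by
  rw [← throughStrands_star]
  exact bottom_mem_halves (star a)

theorem exists_bottom_eq_top_eq {k : ℕ} {h h' : ℕ → Option ℕ} (hh : h ∈ halves n k)
    (hh' : h' ∈ halves n k) : ∃ a : Diagram n, a.bottom = h ∧ a.top = h' := by
  have := hh.1.finite_defects.fintype
  have := hh'.1.finite_defects.fintype
  have hcard : Fintype.card (defects h) = Fintype.card (defects h') := by
    rw [← Nat.card_eq_fintype_card, ← Nat.card_eq_fintype_card]
    exact hh.2.trans hh'.2.symm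
  let e := (Fintype.orderIsoFinOfCardEq (defects h) hcard).symm.trans
    (Fintype.orderIsoFinOfCardEq (defects h') rfl)
  exact ⟨ofHalves hh.1 hh'.1 e, bottom_ofHalves _ _ _, top_ofHalves _ _ _⟩

theorem bijOn_bottom_top (n k : ℕ) : Set.BijOn (fun a : Diagram n => (a.bottom, a.top))
    {a | a.throughStrands = k} (halves n k ×ˢ halves n k) := by
  refine ⟨fun a ha => ?_, fun a _ b _ hab => ?_, ?_⟩
  · obtain rfl : a.throughStrands = k := ha
    exact ⟨a.bottom_mem_halves, a.top_mem_halves⟩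
  · exact eq_of_bottom_eq_of_top_eq (congrArg Prod.fst hab) (congrArg Prod.snd hab)
  · rintro ⟨h, h'⟩ ⟨hh, hh'⟩
    obtain ⟨a, rfl, rfl⟩ := exists_bottom_eq_top_eq hh hh'
    exact ⟨a, a.ncard_defects_bottom.symm.trans hh.2, rfl⟩

end Reconstruction

section Product

variable {n : ℕ} {a c : Diagram n}

theorem partner_mul_of_inl {i j : Fin n} (hij : a.partner (.inl i) = .inl j) :
    (c * a).partner (.inl i) = .inl j := by
  have hrel : ∀ w, a.rel (.inl i) w ↔ w = .inl i ∨ w = .inl j := partner_eq_iff.1 hij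
  -- `f` marks an arc of the bottom half of `a`: it misses the middle row, so the stack keeps it.
  let f : StackNode n → Prop
    | .bottom m => a.rel (.inl i) (.inl m)
    | .middle _ => False
    | .top _ => False
  have f_lower (u : Node n) : f (.lower u) = a.rel (.inl i) u := by
    rcases u with m | m
    · rfl
    · exact (eq_false (by simp [hrel])).symm
  have f_upper (u : Node n) : f (.upper u) = False := by rcases u with m | m <;> rfl
  refine partner_eq_iff.2 fun w => ⟨fun hw => ?_, fun hw => ?_⟩
  · have hlabel : f (.bottom i) = f (.outer w) :=
      label_eq f (fun u v _ => by rw [f_upper, f_upper])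
        (fun u v huv => by
          rw [f_lower, f_lower]
          exact propext ⟨fun h => a.rel.trans h huv, fun h => a.rel.trans h (a.rel.symm huv)⟩) hw
    have hfw : f (.outer w) := hlabel ▸ a.rel.refl (.inl i)
    rcases w with m | m
    · exact (hrel _).1 hfw
    · exact hfw.elim
  · rcases hw with rfl | rfl
    · exact (c * a).rel.refl _
    · exact .rel _ _ (.lower (u := .inl i) (v := .inl j) ((hrel _).2 (Or.inr rfl)))

theorem partner_mul_of_inr {i x j : Fin n} (hix : a.partner (.inl i) = .inr x)
    (hxj : c.partner (.inl x) = .inr j) : (c * a).partner (.inl i) = .inr j := by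
  have hlower : StackLink c.rel a.rel (.bottom i) (.middle x) :=
    .lower (u := .inl i) (v := .inr x) (rel_iff.2 (Or.inr hix.symm))
  have hupper : StackLink c.rel a.rel (.middle x) (.top j) :=
    .upper (u := .inl x) (v := .inr j) (rel_iff.2 (Or.inr hxj.symm))
  have hrel : (c * a).rel (.inl i) (.inr j) :=
    Relation.EqvGen.trans _ _ _ (.rel _ _ hlower) (.rel _ _ hupper)
  exact ((rel_iff.1 hrel).resolve_left Sum.inr_ne_inl).symm

theorem bottom_mul_eq_some {x y : ℕ} (hxy : a.bottom x = some y) :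
    (c * a).bottom x = some y := by
  by_cases hx : x < n
  · lift x to Fin n using hx
    obtain ⟨j, hj, rfl⟩ := bottom_eq_some_iff_exists.1 hxy
    exact bottom_eq_some_iff.2 (partner_mul_of_inl hj)
  · rw [bottom_of_le (not_lt.1 hx)] at hxy ⊢
    exact hxy

theorem defects_bottom_mul_subset (c a : Diagram n) :
    defects (c * a).bottom ⊆ defects a.bottom := by
  intro x hx
  by_contra hxa
  obtain ⟨y, hy⟩ := Option.ne_none_iff_exists'.1 hxa
  exact Option.some_ne_none y ((bottom_mul_eq_some hy).symm.trans hx)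

theorem throughStrands_mul_le_right (c a : Diagram n) :
    (c * a).throughStrands ≤ a.throughStrands := by
  rw [← ncard_defects_bottom, ← ncard_defects_bottom]
  exact Set.ncard_le_ncard (defects_bottom_mul_subset c a) a.isHalf_bottom.finite_defects

theorem throughStrands_mul_le_left (c a : Diagram n) :
    (c * a).throughStrands ≤ c.throughStrands := by
  rw [← throughStrands_star, star_mul, ← throughStrands_star c]
  exact throughStrands_mul_le_right _ _

theorem ncard_defects_inter_le (c a : Diagram n) :
    (defects c.bottom ∩ defects a.top).ncard ≤ (c * a).throughStrands := by
  have hthrough (x : ℕ) (hx : x ∈ defects c.bottom ∩ defects a.top) :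
      ∃ i : ℕ, i ∈ defects (c * a).bottom ∧
        ∃ (hi : i < n) (hx : x < n), a.partner (.inl ⟨i, hi⟩) = .inr ⟨x, hx⟩ := by
    obtain ⟨hxc, hxa⟩ := hx
    lift x to Fin n using c.isHalf_bottom.lt_of_mem_defects hxc
    obtain ⟨j, hj⟩ := mem_defects_bottom.1 hxc
    obtain ⟨i, hi⟩ := mem_defects_top.1 hxa
    exact ⟨i, mem_defects_bottom.2 ⟨j, partner_mul_of_inr hi hj⟩, i.2, x.2, hi⟩
  choose! f hf hfn hn hfx using hthrough
  rw [← ncard_defects_bottom]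
  refine Set.ncard_le_ncard_of_injOn f hf (fun x hx y hy hxy => ?_)
    (c * a).isHalf_bottom.finite_defects
  have := hfx x hx
  simp only [hxy, hfx y hy, Sum.inr.injEq, Fin.mk.injEq] at this
  exact this.symm

theorem bottom_mul_of_le (hle : a.throughStrands ≤ (c * a).throughStrands) :
    (c * a).bottom = a.bottom := by
  rw [← ncard_defects_bottom, ← ncard_defects_bottom] at hle
  have hdefects : defects (c * a).bottom = defects a.bottom :=
    Set.eq_of_subset_of_ncard_le (defects_bottom_mul_subset c a) hle
      a.isHalf_bottom.finite_defects
  funext x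
  rcases hx : a.bottom x with _ | y
  · exact hdefects.ge hx
  · exact bottom_mul_eq_some hx

theorem top_mul_of_le (hle : c.throughStrands ≤ (c * a).throughStrands) :
    (c * a).top = c.top := by
  rw [← throughStrands_star, ← throughStrands_star (c * a), star_mul] at hle
  rw [← bottom_star, star_mul, bottom_mul_of_le hle, bottom_star]

theorem bottom_mul_and_top_mul (hca : c.bottom = a.top) :
    (c * a).bottom = a.bottom ∧ (c * a).top = c.top := by
  have hle := ncard_defects_inter_le c a
  have hstrands : c.throughStrands = a.throughStrands := by
    rw [← ncard_defects_bottom, hca, ← bottom_star, ncard_defects_bottom, throughStrands_star]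
  rw [hca, Set.inter_self, ← hca, ncard_defects_bottom] at hle
  exact ⟨bottom_mul_of_le (hstrands ▸ hle), top_mul_of_le hle⟩

theorem isIdempotentElem_of_bottom_eq_top (ha : a.bottom = a.top) : IsIdempotentElem a :=
  have h := bottom_mul_and_top_mul ha
  eq_of_bottom_eq_of_top_eq h.1 h.2

end Product

section Green

open GreenCell

variable {n : ℕ} {a b : Diagram n}

theorem throughStrands_le (a : Diagram n) : a.throughStrands ≤ n := by
  rw [← ncard_defects_bottom]
  exact (Set.ncard_le_ncard (t := Set.Iio n) fun x => a.isHalf_bottom.lt_of_mem_defects).trans_eq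
    (Set.ncard_Iio_nat n)

theorem leftLE_of_bottom_eq (hab : a.bottom = b.bottom) : LeftLE a b := by
  have hstrands : b.throughStrands = a.throughStrands := by
    rw [← ncard_defects_bottom, ← hab, ncard_defects_bottom]
  obtain ⟨c, hca, hcb⟩ := exists_bottom_eq_top_eq a.top_mem_halves (hstrands ▸ b.top_mem_halves)
  obtain ⟨hbot, htop⟩ := bottom_mul_and_top_mul hca
  exact ⟨c, eq_of_bottom_eq_of_top_eq (hab ▸ hbot.symm) (hcb ▸ htop.symm)⟩

theorem rightLE_of_top_eq (hab : a.top = b.top) : RightLE a b :=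
  rightLE_iff_leftLE_star.2 (leftLE_of_bottom_eq hab)

theorem leftLE_antisymm_iff : LeftLE a b ∧ LeftLE b a ↔ b.bottom = a.bottom := by
  refine ⟨?_, fun h => ⟨leftLE_of_bottom_eq h.symm, leftLE_of_bottom_eq h⟩⟩
  rintro ⟨⟨c, rfl⟩, d, hd⟩
  refine bottom_mul_of_le ?_
  conv_lhs => rw [hd]
  exact throughStrands_mul_le_right _ _

theorem exists_leftLE_throughStrands_eq {j : ℕ} (hj : j ≤ a.throughStrands) :
    ∃ b, LeftLE a b ∧ b.throughStrands = j := by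
  rw [← throughStrands_star, ← ncard_defects_bottom, bottom_star] at hj
  obtain ⟨S, hSa, rfl⟩ := Set.exists_subset_card_eq hj
  have hS : arclessHalf S ∈ halves n S.ncard :=
    arclessHalf_mem_halves fun x hx => a.isHalf_top.lt_of_mem_defects (hSa hx)
  obtain ⟨c, hbot, -⟩ := exists_bottom_eq_top_eq hS hS
  refine ⟨c * a, ⟨c, rfl⟩, le_antisymm ?_ ?_⟩
  · refine (throughStrands_mul_le_left c a).trans_eq ?_
    rw [← ncard_defects_bottom, hbot, defects_arclessHalf]
  · have := ncard_defects_inter_le c a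
    rwa [hbot, defects_arclessHalf, Set.inter_eq_left.2 hSa] at this

theorem twoSidedLE_iff : TwoSidedLE a b ↔ b.throughStrands ≤ a.throughStrands := by
  constructor
  · rintro ⟨c, d, rfl⟩
    exact (throughStrands_mul_le_left _ d).trans (throughStrands_mul_le_right c a)
  · intro h
    obtain ⟨x, ⟨c, rfl⟩, hx⟩ := exists_leftLE_throughStrands_eq h
    obtain ⟨y, hyb, hyx⟩ := exists_bottom_eq_top_eq b.bottom_mem_halves
      (hx ▸ (c * a).top_mem_halves)
    obtain ⟨d, rfl⟩ := rightLE_of_top_eq hyx.symm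
    obtain ⟨c', rfl⟩ := leftLE_of_bottom_eq hyb
    exact ⟨c' * c, d, by simp only [mul_assoc]⟩

theorem exists_throughStrands_eq {k : ℕ} (hk : k ≤ n) : ∃ a : Diagram n, a.throughStrands = k := by
  have hhalf := arclessHalf_mem_halves (Set.Iio_subset_Iio hk)
  rw [Set.ncard_Iio_nat] at hhalf
  obtain ⟨a, ha, -⟩ := exists_bottom_eq_top_eq hhalf hhalf
  exact ⟨a, by rw [← ncard_defects_bottom, ha, hhalf.2]⟩

theorem exists_isIdempotentElem (a : Diagram n) :
    ∃ e : Diagram n, e.throughStrands = a.throughStrands ∧ IsIdempotentElem e := by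
  obtain ⟨e, hbot, htop⟩ := exists_bottom_eq_top_eq a.bottom_mem_halves a.bottom_mem_halves
  exact ⟨e, by rw [← ncard_defects_bottom, hbot, ncard_defects_bottom],
    isIdempotentElem_of_bottom_eq_top (hbot.trans htop.symm)⟩

end Green

section Cells

open GreenCell

variable {n k : ℕ} {L R : Set (Diagram n)}

theorem isJCell_iff {J : Set (Diagram n)} :
    IsJCell J ↔ ∃ a : Diagram n, J = {b | b.throughStrands = a.throughStrands} :=
  exists_congr fun a => by
    rw [setOf_twoSidedLE_antisymm (f := fun a : Diagram n => OrderDual.toDual a.throughStrands)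
      (fun _ _ => twoSidedLE_iff)]
    rfl

theorem isLeftCell_iff : IsLeftCell L ↔ ∃ a : Diagram n, L = {b | b.bottom = a.bottom} :=
  exists_congr fun a => by simp only [leftLE_antisymm_iff]

theorem isLeftCell_and_subset_iff : IsLeftCell L ∧ L ⊆ {a | a.throughStrands = k} ↔
    ∃ h ∈ halves n k, L = {a | a.bottom = h} := by
  rw [isLeftCell_iff]
  constructor
  · rintro ⟨⟨a, rfl⟩, hk⟩
    have ha : a.throughStrands = k := hk rfl
    exact ⟨a.bottom, ha ▸ a.bottom_mem_halves, rfl⟩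
  · rintro ⟨h, hh, rfl⟩
    obtain ⟨a, rfl, -⟩ := exists_bottom_eq_top_eq hh hh
    refine ⟨⟨a, rfl⟩, fun b hb => ?_⟩
    rw [Set.mem_ofPred_eq, ← ncard_defects_bottom, hb, hh.2]

theorem preimage_star_setOf_throughStrands :
    star ⁻¹' {a : Diagram n | a.throughStrands = k} = {a | a.throughStrands = k} :=
  Set.ext fun a => by rw [Set.mem_preimage, Set.mem_ofPred_eq, throughStrands_star]; rfl

theorem isRightCell_and_subset_iff : IsRightCell R ∧ R ⊆ {a | a.throughStrands = k} ↔
    ∃ h ∈ halves n k, R = {a | a.top = h} := by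
  have hstar (h : ℕ → Option ℕ) :
      {a : Diagram n | a.bottom = h} = star ⁻¹' {a : Diagram n | a.top = h} := by
    simp only [Set.preimage_ofPred_eq, top_star]
  rw [isRightCell_iff_isLeftCell_preimage_star,
    ← star_involutive.surjective.preimage_subset_preimage_iff
      (t := {a : Diagram n | a.throughStrands = k}),
    preimage_star_setOf_throughStrands, isLeftCell_and_subset_iff]
  simp only [hstar, (Set.preimage_injective.2 star_involutive.surjective).eq_iff]

theorem bijOn_top {h : ℕ → Option ℕ} (hh : h ∈ halves n k) :
    Set.BijOn top {a : Diagram n | a.bottom = h} (halves n k) := by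
  refine ⟨fun a ha => ?_, fun a ha b hb => eq_of_bottom_eq_of_top_eq (ha.trans hb.symm),
    fun h' hh' => exists_bottom_eq_top_eq hh hh'⟩
  have : a.throughStrands = k := by rw [← ncard_defects_bottom, ha, hh.2]
  exact this ▸ a.top_mem_halves

theorem ncard_eq_of_isLeftCell (hL : IsLeftCell L) (hk : L ⊆ {a | a.throughStrands = k}) :
    L.ncard = (halves n k).ncard := by
  obtain ⟨h, hh, rfl⟩ := isLeftCell_and_subset_iff.1 ⟨hL, hk⟩
  exact (bijOn_top hh).ncard_eq

theorem ncard_eq_of_isRightCell (hR : IsRightCell R) (hk : R ⊆ {a | a.throughStrands = k}) :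
    R.ncard = (halves n k).ncard := by
  rw [← ncard_preimage_star]
  refine ncard_eq_of_isLeftCell (isRightCell_iff_isLeftCell_preimage_star.1 hR) ?_
  rw [← preimage_star_setOf_throughStrands]
  exact Set.preimage_mono hk

theorem ncard_leftCells (n k : ℕ) :
    {L : Set (Diagram n) | IsLeftCell L ∧ L ⊆ {a | a.throughStrands = k}}.ncard =
      (halves n k).ncard := by
  have himage : {L : Set (Diagram n) | IsLeftCell L ∧ L ⊆ {a | a.throughStrands = k}} =
      (fun h => {a | a.bottom = h}) '' halves n k :=
    Set.ext fun L => isLeftCell_and_subset_iff.trans <|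
      exists_congr fun h => and_congr_right fun _ => eq_comm
  rw [himage]
  refine Set.InjOn.ncard_image fun h hh h' _ heq => ?_
  obtain ⟨a, rfl, -⟩ := exists_bottom_eq_top_eq hh hh
  exact heq.le (show a.bottom = a.bottom from rfl)

theorem ncard_rightCells (n k : ℕ) :
    {R : Set (Diagram n) | IsRightCell R ∧ R ⊆ {a | a.throughStrands = k}}.ncard =
      (halves n k).ncard :=
  (ncard_rightCells_eq_ncard_leftCells preimage_star_setOf_throughStrands).trans
    (ncard_leftCells n k)

theorem ncard_setOf_throughStrands (n k : ℕ) :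
    {a : Diagram n | a.throughStrands = k}.ncard = (halves n k).ncard ^ 2 := by
  rw [(bijOn_bottom_top n k).ncard_eq, Set.ncard_prod, sq]

theorem exists_inter_eq_singleton (hL : IsLeftCell L) (hLk : L ⊆ {a | a.throughStrands = k})
    (hR : IsRightCell R) (hRk : R ⊆ {a | a.throughStrands = k}) : ∃ a, L ∩ R = {a} := by
  obtain ⟨h, hh, rfl⟩ := isLeftCell_and_subset_iff.1 ⟨hL, hLk⟩
  obtain ⟨h', hh', rfl⟩ := isRightCell_and_subset_iff.1 ⟨hR, hRk⟩
  obtain ⟨a, rfl, rfl⟩ := exists_bottom_eq_top_eq hh hh'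
  exact ⟨a, Set.ext fun b => ⟨fun hb => eq_of_bottom_eq_of_top_eq hb.1 hb.2, by rintro rfl; simp⟩⟩

end Cells

end Diagram

theorem ncard_halves_eq_sum (n k : ℕ) : ((halves n k).ncard : ℚ) =
    ∑ t ∈ Finset.range (n + 1), ((k : ℚ) + 1) / ((k : ℚ) + (t : ℚ) + 1) *
      (n.choose (k + 2 * t) : ℚ) * ((k + 2 * t).choose t : ℚ) := by
  rw [ncard_halves, motzkinTriangle_eq_ballotSum, ballotSum]
  exact Finset.sum_congr rfl fun t _ => by rw [ballot]; ring

end Motzkin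

theorem mainTheorem7 (n : ℕ) :
    -- The number of through strands gives an order isomorphism from the J-cells to `{n, …, 0}`.
    (∃ φ : GreenCell.JCell (Motzkin.Diagram n) ≃o (Fin (n + 1))ᵒᵈ,
      ∀ (J : GreenCell.JCell (Motzkin.Diagram n)) (a : Motzkin.Diagram n), a ∈ J.1 →
        ((OrderDual.ofDual (φ J) : Fin (n + 1)) : ℕ) = a.throughStrands) ∧
    -- Let `J` be the J-cell of diagrams with `k` through strands, and `ℓ` the claimed number.
    ∀ (J : Set (Motzkin.Diagram n)) (k : ℕ) (ℓ : ℚ), GreenCell.IsJCell J →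
      (∃ a ∈ J, a.throughStrands = k) →
      ℓ = ∑ t ∈ Finset.range (n + 1), ((k : ℚ) + 1) / ((k : ℚ) + (t : ℚ) + 1) *
        (n.choose (k + 2 * t) : ℚ) * ((k + 2 * t).choose t : ℚ) →
      -- numbers of left and right cells in `J`
      ({L : Set (Motzkin.Diagram n) | GreenCell.IsLeftCell L ∧ L ⊆ J}.ncard : ℚ) = ℓ ∧
      ({R : Set (Motzkin.Diagram n) | GreenCell.IsRightCell R ∧ R ⊆ J}.ncard : ℚ) = ℓ ∧
      -- sizes of left and right cells in `J`
      (∀ L : Set (Motzkin.Diagram n), GreenCell.IsLeftCell L → L ⊆ J → (L.ncard : ℚ) = ℓ) ∧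
      (∀ R : Set (Motzkin.Diagram n), GreenCell.IsRightCell R → R ⊆ J → (R.ncard : ℚ) = ℓ) ∧
      -- size of `J`
      (J.ncard : ℚ) = ℓ ^ 2 ∧
      -- `J` is idempotent
      (∃ e ∈ J, IsIdempotentElem e) ∧
      -- the H-cells in `J` have one element, and the idempotent ones are trivial groups
      ∀ L R : Set (Motzkin.Diagram n), GreenCell.IsLeftCell L → L ⊆ J →
        GreenCell.IsRightCell R → R ⊆ J →
        (L ∩ R).ncard = 1 ∧
        ∀ e ∈ L ∩ R, IsIdempotentElem e →
          ∃ H : Subsemigroup (Motzkin.Diagram n), (H : Set (Motzkin.Diagram n)) = L ∩ R ∧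
            Nonempty (H ≃* Unit) := by
  refine ⟨?_, ?_⟩
  · obtain ⟨φ, hφ⟩ := GreenCell.exists_orderIso_jCell (M := Motzkin.Diagram n)
      (f := fun a => OrderDual.toDual
        (⟨a.throughStrands, Nat.lt_succ_of_le a.throughStrands_le⟩ : Fin (n + 1)))
      (fun _ _ => Motzkin.Diagram.twoSidedLE_iff) fun k => by
        obtain ⟨a, ha⟩ := Motzkin.Diagram.exists_throughStrands_eq (Nat.le_of_lt_succ k.2)
        exact ⟨a, Fin.ext ha⟩
    exact ⟨φ, fun J a ha => congrArg Fin.val (hφ J a ha)⟩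
  · rintro J k ℓ hJ ⟨a, haJ, rfl⟩ rfl
    obtain ⟨b, rfl⟩ := Motzkin.Diagram.isJCell_iff.1 hJ
    rw [← Motzkin.ncard_halves_eq_sum, show b.throughStrands = a.throughStrands from haJ.symm]
    refine ⟨by rw [Motzkin.Diagram.ncard_leftCells], by rw [Motzkin.Diagram.ncard_rightCells],
      fun L hL hLJ => by rw [Motzkin.Diagram.ncard_eq_of_isLeftCell hL hLJ],
      fun R hR hRJ => by rw [Motzkin.Diagram.ncard_eq_of_isRightCell hR hRJ],
      by rw [Motzkin.Diagram.ncard_setOf_throughStrands, Nat.cast_pow],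
      a.exists_isIdempotentElem, fun L R hL hLJ hR hRJ => ?_⟩
    obtain ⟨c, hc⟩ := Motzkin.Diagram.exists_inter_eq_singleton hL hLJ hR hRJ
    rw [hc]
    refine ⟨Set.ncard_singleton c, ?_⟩
    rintro _ rfl he
    exact GreenCell.exists_subsemigroup_singleton he
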